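/- **Setting.** Let $\Theta\subset\mathbb R^q$ ($q$ arbitrary) and let $\{p(x\mid\theta)\}_{\theta\in\Theta}$ be a family of probability densities with respect to a measure $\lambda$ on a measurable space $\mathfrak X$. Let $\mathcal E_k(\Theta)$ (resp. $\mathcal G_k(\Theta)$) be the set of discrete probability measures on $\Theta$ with exactly $k$ (resp. at least one and at most $k$) distinct atoms. For $G=\sum_i p_i\delta_{\theta_i}$ let $\mathbb P_G$ be the mixture distribution with $\lambda$-density $\sum_i p_i\,p(x\mid\theta_i)$, and let $\mathbb E_{G}$ denote expectation when $X_1,\dots,X_n$ are i.i.d. from $\mathbb P_{G}$. Let $W_1$ be the Wasserstein-1 distance (with Euclidean ground distance) between probability measures on $\Theta$, and let $\mathfrak E_n$ be the set of all estimators, i.e. measurable maps $\hat G_n$ from samples $(X_1,\dots,X_n)\in\mathfrak X^n$ to probability measures on $\Theta$. For $\theta_0\in\Theta$, $m\ge1$, $b>0$ and $0\le A<\infty$, say that *Assumption $A(\theta_0,m)$ holds with radius $b$ and constant $A$* if 1) for $\lambda$-a.e. $x$, $p(x\mid\theta)$ is $m$ times continuously differentiable in $\theta$ on $\{\theta\in\Theta:\|\theta-\theta_0\|_2<b\}$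 (at points that are not interior to $\Theta$, derivatives are taken relative to this set, e.g. inherited from an extension to a larger domain); and 2) there is a unit vector $\psi\in\mathbb R^q$ such that $\theta_0+\theta'\in\Theta$ for all $\theta'\in\operatorname{span}(\psi)$ with $\|\theta'\|_2<b$ and $$\max_{|\alpha|=m}\ \sup_{\substack{\theta'\in\operatorname{span}(\psi)\\ \|\theta'\|_2<b}}\ \sup_{t\in[0,1]}\int\frac{\left(D^\alpha p(x\mid\theta_0+t\theta')\right)^2}{p(x\mid\theta_0+\theta')}\,d\lambda\ \le\ A ,$$ where $D^\alpha$ is the partial derivative in $\theta$, and $c/0=\infty$ for $c>0$, $0/0=0$. **Theorem (minimax lower bound).** (a) Let $k\ge1$ and suppose that Assumption $A(\theta_0,2k-1)$ holds with radius $b$ and constant $A$ for some $\theta_0\in\Theta$. Then for every $n\ge1$, $$\inf_{\hat G_n\in\mathfrak E_n}\ \sup_{G^*\in\mathcal G_k(\Theta)}\mathbb E_{G^*}W_1(\hat G_n,G^*)\ \ge\ C\,n^{-\frac1{4k-2}},$$ where $C>0$ depends only on $A,q,k,b$. (b) Let $1\le k_0\le k$, $G_0\in\mathcal E_{k_0}(\Theta)$,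 $d_1=k-k_0+1$ and $a>0$. Suppose that Assumption $A(\theta_0,2d_1-1)$ holds with radius $b$ and constant $A$ at some support point $\theta_0$ of $G_0$. Then for every $n\ge1$, $$\inf_{\hat G_n\in\mathfrak E_n}\ \sup_{\substack{G^*\in\mathcal G_k(\Theta)\\ W_1(G^*,G_0)<a\,n^{-1/(4d_1-2)}}}\mathbb E_{G^*}W_1(\hat G_n,G^*)\ \ge\ C\,n^{-\frac1{4d_1-2}},$$ where $C>0$ depends only on $A,q,d_1,b,a$ and $G_0(\{\theta_0\})$. -/

import Mathlib

open MeasureTheory Set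
open scoped ENNReal NNReal

universe u

/-- The parameter space `ℝ^q` with its Euclidean norm. -/
abbrev Param (q : ℕ) : Type := EuclideanSpace ℝ (Fin q)

/-- `p x θ`, `θ ∈ Θ`, is a family of probability densities (in `x`) with respect to the dominating
measure `μ`. The values of `p x θ` for `θ ∉ Θ` play no role anywhere. -/
structure IsDensityFamily {X : Type u} [MeasurableSpace X] {q : ℕ} (μ : Measure X)
    (Θ : Set (Param q)) (p : X → Param q → ℝ) : Prop where
  measurable : ∀ θ ∈ Θ, Measurable fun x => p x θ
  nonneg : ∀ θ ∈ Θ, ∀ x, 0 ≤ p x θ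
  lintegral_eq_one : ∀ θ ∈ Θ, ∫⁻ x, ENNReal.ofReal (p x θ) ∂μ = 1

/-- `𝓔_k(Θ)`: the discrete probability measures on `Θ` with exactly `k` distinct atoms. -/
def exactlyAtoms {q : ℕ} (Θ : Set (Param q)) (k : ℕ) : Set (ProbabilityMeasure Θ) :=
  {G | ∃ (θ : Fin k → Θ) (w : Fin k → ℝ≥0), Function.Injective θ ∧ (∀ i, 0 < w i) ∧
    (G : Measure Θ) = ∑ i, (w i : ℝ≥0∞) • Measure.dirac (θ i)}

/-- `𝓖_k(Θ)`: the discrete probability measures on `Θ` with at most `k` distinct atoms. -/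
def atMostAtoms {q : ℕ} (Θ : Set (Param q)) (k : ℕ) : Set (ProbabilityMeasure Θ) :=
  {G | ∃ l, 1 ≤ l ∧ l ≤ k ∧ G ∈ exactlyAtoms Θ l}

/-- The Wasserstein-1 distance on probability measures on `Θ`, with respect to the Euclidean
distance: the infimum of the transport cost over all couplings. -/
noncomputable def wasserstein1 {q : ℕ} {Θ : Set (Param q)} (G H : ProbabilityMeasure Θ) : ℝ≥0∞ :=
  ⨅ π ∈ {π : Measure (Θ × Θ) | π.map Prod.fst = (G : Measure Θ) ∧ π.map Prod.snd = (H : Measure Θ)},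
    ∫⁻ z, edist z.1 z.2 ∂π

/-- The mixture distribution `P_G`, with density `∫ p(x | θ) dG(θ)`, that is `∑ᵢ pᵢ p(x | θᵢ)` for
`G = ∑ᵢ pᵢ δ_{θᵢ}`. -/
noncomputable def mixture {X : Type u} [MeasurableSpace X] {q : ℕ} (μ : Measure X)
    {Θ : Set (Param q)} (p : X → Param q → ℝ) (G : ProbabilityMeasure Θ) : Measure X :=
  μ.withDensity fun x => ∫⁻ θ : Θ, ENNReal.ofReal (p x θ) ∂(G : Measure Θ)

/-- The minimax `W₁` risk over the class `S` of mixing measures. The infimum is over all estimators,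
the measurable maps of the sample `x = (x₁, …, xₙ)` into the probability measures on `Θ`; the
expectation is under `n` independent draws from the mixture `P_G`. -/
noncomputable def minimaxRisk {X : Type u} [MeasurableSpace X] {q : ℕ} (μ : Measure X)
    {Θ : Set (Param q)} (p : X → Param q → ℝ) (n : ℕ) (S : Set (ProbabilityMeasure Θ)) : ℝ≥0∞ :=
  ⨅ est ∈ {est : (Fin n → X) → ProbabilityMeasure Θ | Measurable est},
    ⨆ G ∈ S, ∫⁻ x, wasserstein1 (est x) G ∂(Measure.pi fun _ : Fin n => mixture μ p G)

/-- Assumption `A(θ₀, m)`, with its radius `b`, its unit vector `ψ` and its constant `A` displayed.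

`D x θ` collects the partial derivatives of `p x` at `θ` of all orders up to `m`; where `Θ` is a
neighbourhood of `θ` they are the usual ones, and on the boundary of `Θ` they are one-sided ones,
such as those inherited from an extension of `p x` to a larger domain. The partial derivative
`∂_{i₁} ⋯ ∂_{iₘ} p x` is `D x θ m` evaluated at the coordinate vectors `e_{i₁}, …, e_{iₘ}`; the
multi-indices `α` with `|α| = m` correspond to the tuples `i` up to the order of the entries.

The quotient is taken in `[0, ∞]`, with `c / 0 = ∞` for `c > 0` and `0 / 0 = 0`. -/
structure AssumptionA {X : Type u} [MeasurableSpace X] {q : ℕ} (μ : Measure X)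
    (Θ : Set (Param q)) (p : X → Param q → ℝ) (θ₀ : Param q) (m : ℕ)
    (b : ℝ) (ψ : Param q) (A : ℝ≥0) : Prop where
  radius_pos : 0 < b
  unit : ‖ψ‖ = 1
  mem : ∀ θ' ∈ Submodule.span ℝ {ψ}, ‖θ'‖ < b → θ₀ + θ' ∈ Θ
  bound : ∃ D : X → Param q → FormalMultilinearSeries ℝ (Param q) ℝ,
    (∀ᵐ x ∂μ, HasFTaylorSeriesUpToOn m (p x) (D x) (Θ ∩ Metric.ball θ₀ b)) ∧
    ∀ i : Fin m → Fin q, ∀ θ' ∈ Submodule.span ℝ {ψ}, ‖θ'‖ < b → ∀ t ∈ Icc (0 : ℝ) 1,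
      AEMeasurable (fun x => D x (θ₀ + t • θ') m fun j => EuclideanSpace.single (i j) 1) μ ∧
      ∫⁻ x, ENNReal.ofReal ((D x (θ₀ + t • θ') m fun j => EuclideanSpace.single (i j) 1) ^ 2) /
        ENNReal.ofReal (p x (θ₀ + θ')) ∂μ ≤ A

/-! The bound is a two-point (Le Cam) argument. Put `m = 2d - 1` and take the `2d` nodes `θ₀ + iεψ`,
`0 ≤ i ≤ m`. Starting from `G₀`, redistribute the mass `w` of `θ₀` over the even nodes for one
mixing measure and over the odd nodes for the other, with weights proportional to `m.choose i`. Each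
has at most `k₀ - 1 + d ≤ k` atoms and lies within `mε` of `G₀` in `W₁`.

The difference of the two mixture densities is a multiple of the `m`-th finite difference of the
density along `ψ`. Taylor polynomials of degree below `m` cancel, leaving integral remainders of
order `ε^m` (`AssumptionA.exists_remainder`). Each remainder is square integrable against the
inverse of the density at its own node, and that density is part of the sum of the two mixtures.
Cauchy–Schwarz then gives a Hellinger affinity of at least `1 - δ` with `δ` of order `ε^(2m)`
(`one_sub_le_affinity`). The squared affinity tensorizes (`le_lintegral_mul_lintegral_pi`), so `n`
observations do not distinguish the two measures when `ε` is a small multiple of `n^(-1/(2m))`, and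
`2m = 4d - 2`.

The mixing measures are nevertheless at distance of order `wε`: a tent function of height `ε` at
`θ₀` sees the node `0` and no other. Its integral is a measurable statistic of the estimator that
bounds the `W₁` loss from below (`half_separation_le_minimaxRisk`). -/

/-! ### Riemann sums and Taylor remainders -/

open Filter Topology Finset in
theorem tendsto_riemannSum_intervalIntegral {f : ℝ → ℝ} (hf : ContinuousOn f (Set.Icc 0 1)) :
    Tendsto (fun N : ℕ => ((N : ℝ) + 1)⁻¹ * ∑ j ∈ range (N + 1), f (j / ((N : ℝ) + 1)))
      atTop (𝓝 (∫ t in (0 : ℝ)..1, f t)) := by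
  have huc := isCompact_Icc.uniformContinuousOn_of_continuous hf
  rw [Metric.uniformContinuousOn_iff] at huc
  rw [Metric.tendsto_atTop]
  intro ε hε
  obtain ⟨δ, hδ, hd⟩ := huc (ε / 2) (by positivity)
  obtain ⟨N₀, hN₀⟩ := exists_nat_gt (1 / δ)
  refine ⟨N₀, fun N hN => ?_⟩
  have hNpos : (0 : ℝ) < (N : ℝ) + 1 := by positivity
  have hNδ : ((N : ℝ) + 1)⁻¹ < δ := by
    rw [inv_lt_comm₀ hNpos hδ, ← one_div]
    have : (N₀ : ℝ) ≤ N := by exact_mod_cast hN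
    linarith
  set a : ℕ → ℝ := fun j => j / ((N : ℝ) + 1) with ha
  have hstep : ∀ j, a (j + 1) - a j = ((N : ℝ) + 1)⁻¹ := by
    intro j; simp only [ha]; push_cast; field_simp; ring
  have hmono : ∀ j, a j ≤ a (j + 1) := fun j => by
    have := hstep j
    have : 0 < ((N : ℝ) + 1)⁻¹ := by positivity
    linarith [hstep j]
  have ha0 : ∀ j, 0 ≤ a j := fun j => by positivity
  have ha1 : ∀ j, j ≤ N + 1 → a j ≤ 1 := fun j hj => by
    simp only [ha]; rw [div_le_one hNpos]; exact_mod_cast hj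
  have hsub : ∀ j < N + 1, Set.Icc (a j) (a (j + 1)) ⊆ Set.Icc 0 1 := fun j hj =>
    Set.Icc_subset_Icc (ha0 j) (ha1 _ hj)
  have hint : ∀ j < N + 1, IntervalIntegrable f volume (a j) (a (j + 1)) := fun j hj =>
    ContinuousOn.intervalIntegrable_of_Icc (hmono j) (hf.mono (hsub j hj))
  have hsum := intervalIntegral.sum_integral_adjacent_intervals hint
  have e0 : a 0 = 0 := by simp [ha]
  have e1 : a (N + 1) = 1 := by simp only [ha]; push_cast; field_simp
  rw [e0, e1] at hsum
  rw [← hsum, Real.dist_eq, Finset.mul_sum, ← Finset.sum_sub_distrib]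
  have hterm : ∀ j ∈ range (N + 1), |((N : ℝ) + 1)⁻¹ * f (a j) - ∫ t in a j..a (j + 1), f t|
      ≤ ε / 2 * ((N : ℝ) + 1)⁻¹ := by
    intro j hj
    have hj' := Finset.mem_range.1 hj
    have : ((N : ℝ) + 1)⁻¹ * f (a j) - ∫ t in a j..a (j + 1), f t
        = ∫ t in a j..a (j + 1), (f (a j) - f t) := by
      rw [intervalIntegral.integral_sub (by simp) (hint j hj'), intervalIntegral.integral_const,
        hstep, smul_eq_mul]
    rw [this, ← hstep j, ← abs_of_nonneg (sub_nonneg.2 (hmono j)), ← Real.norm_eq_abs]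
    refine intervalIntegral.norm_integral_le_of_norm_le_const fun t ht => ?_
    rw [Set.uIoc_of_le (hmono j)] at ht
    rw [← dist_eq_norm]
    refine (hd _ (hsub j hj' (Set.left_mem_Icc.2 (hmono j))) _
      (hsub j hj' (Set.Ioc_subset_Icc_self ht)) ?_).le
    rw [dist_comm, Real.dist_eq, abs_of_nonneg (by linarith [ht.1])]
    linarith [ht.2, hstep j]
  calc _ ≤ ∑ j ∈ range (N + 1), ε / 2 * ((N : ℝ) + 1)⁻¹ :=
        (Finset.abs_sum_le_sum_abs _ _).trans (Finset.sum_le_sum hterm)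
    _ = ε / 2 := by
        rw [Finset.sum_const, card_range, nsmul_eq_mul]; push_cast; field_simp
    _ < ε := by linarith

/-- Taylor's formula with integral remainder along a chain of derivatives. -/
theorem taylor_integral_of_hasDerivAt_chain {m : ℕ} {h : ℕ → ℝ → ℝ}
    (hd : ∀ j ≤ m, ∀ t ∈ Icc (0 : ℝ) 1, HasDerivAt (h j) (h (j + 1) t) t)
    (hc : ContinuousOn (h (m + 1)) (Icc 0 1)) :
    h 0 1 = ∑ j ∈ Finset.range (m + 1), h j 0 / j.factorial +
      ∫ t in (0 : ℝ)..1, (1 - t) ^ m / m.factorial * h (m + 1) t := by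
  induction m with
  | zero =>
    have := intervalIntegral.integral_eq_sub_of_hasDerivAt (a := 0) (b := 1) (f := h 0)
      (f' := h 1) (fun t ht => hd 0 le_rfl t (by simpa using ht))
      (ContinuousOn.intervalIntegrable_of_Icc zero_le_one hc)
    simp [this]
  | succ m ih =>
    have hcm : ContinuousOn (h (m + 1)) (Icc 0 1) := fun t ht =>
      (hd (m + 1) le_rfl t ht).continuousAt.continuousWithinAt
    rw [ih (fun j hj => hd j (by omega)) hcm, Finset.sum_range_succ _ (m + 1), add_assoc]
    congr 1
    have hu : ∀ t ∈ uIcc (0 : ℝ) 1, HasDerivAt (fun t : ℝ => -((1 - t) ^ (m + 1) / (m + 1).factorial))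
        ((1 - t) ^ m / m.factorial) t := by
      intro t _
      have h1 := ((((hasDerivAt_id t).const_sub 1).pow (m + 1)).div_const
        ((m + 1).factorial : ℝ)).neg
      refine h1.congr_deriv ?_
      have : (m.factorial : ℝ) ≠ 0 := by positivity
      rw [Nat.factorial_succ]
      push_cast
      simp only [id]
      field_simp
    have hv : ∀ t ∈ uIcc (0 : ℝ) 1, HasDerivAt (h (m + 1)) (h (m + 1 + 1) t) t := fun t ht =>
      hd (m + 1) le_rfl t (by simpa using ht)
    have hi1 : IntervalIntegrable (fun t : ℝ => (1 - t) ^ m / (m.factorial : ℝ)) volume 0 1 :=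
      Continuous.intervalIntegrable (by fun_prop) _ _
    have key := intervalIntegral.integral_mul_deriv_eq_deriv_mul hu hv hi1
      (ContinuousOn.intervalIntegrable_of_Icc zero_le_one hc)
    simp only [neg_mul, intervalIntegral.integral_neg, sub_self, sub_zero, one_pow,
      zero_pow (Nat.succ_ne_zero m), zero_div, zero_mul, neg_zero, zero_sub, neg_neg] at key
    rw [one_div_mul_eq_div] at key
    linarith

-- Only the slices `h t` are assumed measurable, so the integral is obtained as an a.e. limit of
-- Riemann sums.
open Filter in
theorem aemeasurable_intervalIntegral_of_continuousOn {X : Type*} [MeasurableSpace X]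
    {μ : Measure X} {h : ℝ → X → ℝ} (hc : ∀ᵐ x ∂μ, ContinuousOn (fun t => h t x) (Icc 0 1))
    (hm : ∀ t ∈ Icc (0 : ℝ) 1, AEMeasurable (h t) μ) :
    AEMeasurable (fun x => ∫ t in (0 : ℝ)..1, h t x) μ := by
  refine aemeasurable_of_tendsto_metrizable_ae atTop (f := fun (N : ℕ) x =>
    ((N : ℝ) + 1)⁻¹ * ∑ j ∈ Finset.range (N + 1), h (j / ((N : ℝ) + 1)) x) (fun N => ?_) ?_
  · refine (Finset.aemeasurable_fun_sum _ fun j hj => hm _ ⟨by positivity, ?_⟩).const_mul _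
    rw [div_le_one (by positivity)]
    exact_mod_cast (Finset.mem_range.1 hj).le
  · filter_upwards [hc] with x hx
    exact tendsto_riemannSum_intervalIntegral hx

-- Jensen's inequality for the square of a mean. It is applied to Riemann sums and passed to the
-- limit by Fatou, so no joint measurability in `(t, x)` is needed.
open Filter Topology in
theorem lintegral_sq_intervalIntegral_div_le {X : Type*} [MeasurableSpace X] {μ : Measure X}
    {h : ℝ → X → ℝ} {g : X → ℝ≥0∞} {K : ℝ≥0∞} (hg : AEMeasurable g μ)
    (hc : ∀ᵐ x ∂μ, ContinuousOn (fun t => h t x) (Icc 0 1))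
    (hm : ∀ t ∈ Icc (0 : ℝ) 1, AEMeasurable (h t) μ)
    (hK : ∀ t ∈ Icc (0 : ℝ) 1, ∫⁻ x, ENNReal.ofReal (h t x ^ 2) / g x ∂μ ≤ K) :
    ∫⁻ x, ENNReal.ofReal ((∫ t in (0 : ℝ)..1, h t x) ^ 2) / g x ∂μ ≤ K := by
  set S : ℕ → X → ℝ := fun N x =>
    ((N : ℝ) + 1)⁻¹ * ∑ j ∈ Finset.range (N + 1), h (j / ((N : ℝ) + 1)) x with hS
  have hmem : ∀ N : ℕ, ∀ j ∈ Finset.range (N + 1), (j : ℝ) / ((N : ℝ) + 1) ∈ Icc (0 : ℝ) 1 := by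
    intro N j hj
    refine ⟨by positivity, ?_⟩
    rw [div_le_one (by positivity)]
    exact_mod_cast (Finset.mem_range.1 hj).le
  have hSm : ∀ N, AEMeasurable (S N) μ := fun N =>
    (Finset.aemeasurable_fun_sum _ fun j hj => hm _ (hmem N j hj)).const_mul _
  have hdm : ∀ t ∈ Icc (0 : ℝ) 1, AEMeasurable (fun x => ENNReal.ofReal (h t x ^ 2) / g x) μ :=
    fun t ht => ((hm t ht).pow_const 2).ennreal_ofReal.div hg
  have hSb : ∀ N, ∫⁻ x, ENNReal.ofReal (S N x ^ 2) / g x ∂μ ≤ K := by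
    intro N
    have hN : (0 : ℝ) < (N : ℝ) + 1 := by positivity
    have hpt : ∀ x, ENNReal.ofReal (S N x ^ 2) / g x ≤ ENNReal.ofReal (((N : ℝ) + 1)⁻¹) *
        ∑ j ∈ Finset.range (N + 1), ENNReal.ofReal (h (j / ((N : ℝ) + 1)) x ^ 2) / g x := by
      intro x
      have h1 : S N x ^ 2 ≤ ((N : ℝ) + 1)⁻¹ *
          ∑ j ∈ Finset.range (N + 1), h (j / ((N : ℝ) + 1)) x ^ 2 := by
        have := sq_sum_le_card_mul_sum_sq (s := Finset.range (N + 1))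
          (f := fun j : ℕ => h (j / ((N : ℝ) + 1)) x)
        rw [Finset.card_range] at this
        push_cast at this
        simp only [hS, mul_pow]
        calc _ ≤ ((N : ℝ) + 1)⁻¹ ^ 2 * (((N : ℝ) + 1) *
              ∑ j ∈ Finset.range (N + 1), h (j / ((N : ℝ) + 1)) x ^ 2) := by gcongr
          _ = _ := by field_simp
      calc _ ≤ ENNReal.ofReal (((N : ℝ) + 1)⁻¹ *
            ∑ j ∈ Finset.range (N + 1), h (j / ((N : ℝ) + 1)) x ^ 2) / g x := by gcongr
        _ = _ := by
          rw [ENNReal.ofReal_mul (by positivity), ENNReal.ofReal_sum_of_nonneg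
            (fun _ _ => sq_nonneg _), mul_div_assoc]
          simp only [div_eq_mul_inv, Finset.sum_mul]
    calc _ ≤ ∫⁻ x, ENNReal.ofReal (((N : ℝ) + 1)⁻¹) *
        ∑ j ∈ Finset.range (N + 1), ENNReal.ofReal (h (j / ((N : ℝ) + 1)) x ^ 2) / g x ∂μ :=
          lintegral_mono hpt
      _ = ENNReal.ofReal (((N : ℝ) + 1)⁻¹) * ∑ j ∈ Finset.range (N + 1),
          ∫⁻ x, ENNReal.ofReal (h (j / ((N : ℝ) + 1)) x ^ 2) / g x ∂μ := by
          rw [lintegral_const_mul' _ _ ENNReal.ofReal_ne_top,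
            lintegral_finsetSum' _ fun j hj => hdm _ (hmem N j hj)]
      _ ≤ ENNReal.ofReal (((N : ℝ) + 1)⁻¹) * ∑ j ∈ Finset.range (N + 1), K := by
          gcongr with j hj
          exact hK _ (hmem N j hj)
      _ = K := by
          rw [Finset.sum_const, Finset.card_range, nsmul_eq_mul, ← mul_assoc,
            ← ENNReal.ofReal_natCast, ← ENNReal.ofReal_mul (by positivity)]
          push_cast
          rw [inv_mul_cancel₀ hN.ne', ENNReal.ofReal_one, one_mul]
  have hlim : ∀ᵐ x ∂μ, ENNReal.ofReal ((∫ t in (0 : ℝ)..1, h t x) ^ 2) / g x ≤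
      liminf (fun N => ENNReal.ofReal (S N x ^ 2) / g x) atTop := by
    filter_upwards [hc] with x hx
    have ht : Tendsto (fun N => ENNReal.ofReal (S N x ^ 2)) atTop
        (𝓝 (ENNReal.ofReal ((∫ t in (0 : ℝ)..1, h t x) ^ 2))) :=
      (ENNReal.continuous_ofReal.tendsto _).comp ((tendsto_riemannSum_intervalIntegral hx).pow 2)
    -- Where `g x = 0` the factor `(g x)⁻¹` is `∞`, and multiplication by `∞` is continuous only
    -- away from `0`.
    by_cases h0 : ENNReal.ofReal ((∫ t in (0 : ℝ)..1, h t x) ^ 2) = 0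
    · rw [h0, ENNReal.zero_div]; exact zero_le
    · simp only [div_eq_mul_inv]
      exact (ENNReal.Tendsto.mul_const ht (Or.inl h0)).liminf_eq.ge
  calc _ ≤ ∫⁻ x, liminf (fun N => ENNReal.ofReal (S N x ^ 2) / g x) atTop ∂μ :=
        lintegral_mono_ae hlim
    _ ≤ liminf (fun N => ∫⁻ x, ENNReal.ofReal (S N x ^ 2) / g x ∂μ) atTop :=
        lintegral_liminf_le' fun N => ((hSm N).pow_const 2).ennreal_ofReal.div hg
    _ ≤ K := by
        refine (liminf_le_liminf (v := fun _ => K) (Eventually.of_forall hSb)).trans ?_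
        simp

/-! ### Finite differences of the density along a line -/

theorem multilinear_diagonal_eq_sum {q m : ℕ}
    (f : ContinuousMultilinearMap ℝ (fun _ : Fin m => Param q) ℝ) (v : Param q) :
    f (fun _ => v) = ∑ i : Fin m → Fin q,
      (∏ j, v (i j)) * f (fun j => EuclideanSpace.single (i j) 1) := by
  have hv : v = ∑ i, v i • EuclideanSpace.single i (1 : ℝ) := by
    ext j
    simp [Pi.single_apply]
  conv_lhs => rw [hv]
  rw [f.map_sum]
  refine Finset.sum_congr rfl fun i _ => ?_
  rw [f.map_smul_univ, smul_eq_mul]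

/-- The diagonal values of a multilinear form are controlled by its values on coordinate vectors. -/
theorem sq_multilinear_diagonal_le {q m : ℕ}
    (f : ContinuousMultilinearMap ℝ (fun _ : Fin m => Param q) ℝ) (v : Param q) :
    f (fun _ => v) ^ 2 ≤ ‖v‖ ^ (2 * m) * ((q : ℝ) ^ m *
      ∑ i : Fin m → Fin q, f (fun j => EuclideanSpace.single (i j) 1) ^ 2) := by
  rw [multilinear_diagonal_eq_sum]
  calc _ ≤ ((Finset.univ : Finset (Fin m → Fin q)).card : ℝ) * ∑ i : Fin m → Fin q,
        ((∏ j, v (i j)) * f (fun j => EuclideanSpace.single (i j) 1)) ^ 2 :=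
        sq_sum_le_card_mul_sum_sq
    _ ≤ (q : ℝ) ^ m * ∑ i : Fin m → Fin q,
        ‖v‖ ^ (2 * m) * f (fun j => EuclideanSpace.single (i j) 1) ^ 2 := by
        simp only [Finset.card_univ, Fintype.card_pi, Fintype.card_fin, Finset.prod_const]
        push_cast
        gcongr with i
        rw [mul_pow]
        gcongr
        rw [← sq_abs, Finset.abs_prod, mul_comm 2 m, pow_mul]
        gcongr
        calc ∏ j, |v (i j)| ≤ ∏ _j : Fin m, ‖v‖ :=
              Finset.prod_le_prod (fun _ _ => abs_nonneg _) fun j _ => by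
                rw [← Real.norm_eq_abs]; exact PiLp.norm_apply_le v (i j)
          _ = ‖v‖ ^ m := by simp
    _ = _ := by rw [← Finset.mul_sum]; ring

-- Up to the sign `(-1) ^ m` this is the `m`-th forward difference at `0` of a monomial of degree
-- below `m`.
open Finset in
theorem sum_alternating_choose_mul_pow {m j : ℕ} (h : j < m) :
    ∑ i ∈ range (m + 1), (-1 : ℝ) ^ i * m.choose i * (i : ℝ) ^ j = 0 := by
  have h1 := congrFun (fwdDiff_iter_pow_eq_zero_of_lt (R := ℝ) h) 0
  rw [fwdDiff_iter_eq_sum_shift] at h1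
  simp only [zero_add, nsmul_eq_mul, mul_one, Pi.zero_apply, zsmul_eq_mul] at h1
  have h2 : ∑ i ∈ range (m + 1), (-1 : ℝ) ^ i * m.choose i * (i : ℝ) ^ j =
      (-1) ^ m * ∑ i ∈ range (m + 1), (((-1 : ℤ) ^ (m - i) * m.choose i : ℤ) : ℝ) * (i : ℝ) ^ j := by
    rw [mul_sum]
    refine sum_congr rfl fun i hi => ?_
    have hi' : i ≤ m := Nat.lt_succ_iff.1 (mem_range.1 hi)
    push_cast
    have : (-1 : ℝ) ^ m * (-1) ^ (m - i) = (-1) ^ i := by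
      rw [← pow_add, show m + (m - i) = 2 * (m - i) + i by omega, pow_add, pow_mul]; simp
    rw [← this]; ring
  rw [h2, h1, mul_zero]

/-- Derivatives along a line through the centre of the ball, from a Taylor series within `Θ`. -/
theorem HasFTaylorSeriesUpToOn.hasDerivAt_line {q m : ℕ} {f : Param q → ℝ}
    {D : Param q → FormalMultilinearSeries ℝ (Param q) ℝ} {s : Set (Param q)}
    (hD : HasFTaylorSeriesUpToOn m f D s) {θ v : Param q} {t : ℝ} {j : ℕ} (hj : j < m)
    (hs : ∀ᶠ r in nhds t, θ + r • v ∈ s) :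
    HasDerivAt (fun r : ℝ => D (θ + r • v) j fun _ => v) (D (θ + t • v) (j + 1) fun _ => v) t := by
  have h1 := hD.fderivWithin j (by exact_mod_cast hj) _ hs.self_of_nhds
  have h2 : HasDerivWithinAt (fun r : ℝ => θ + r • v) v {r | θ + r • v ∈ s} t := by
    simpa using (((hasDerivAt_id t).smul_const v).const_add θ).hasDerivWithinAt
  have h3 := (h1.comp_hasDerivWithinAt t h2 (fun r hr => hr)).hasDerivAt hs
  have h4 := (ContinuousMultilinearMap.apply ℝ (fun _ : Fin j => Param q) ℝ
    (fun _ => v)).hasFDerivAt.comp_hasDerivAt t h3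
  refine h4.congr_deriv ?_
  simp only [ContinuousMultilinearMap.apply_apply, ContinuousMultilinearMap.curryLeft_apply]
  congr 1
  ext i
  refine Fin.cases ?_ (fun i => ?_) i <;> simp

/-- Since `c < b` strictly, the line stays in the set on both sides of `t`, also at `t = 0` and `t =
1`. Derivatives along it are therefore two-sided even when `θ₀` is a boundary point of `Θ`. -/
theorem AssumptionA.eventually_line_mem {X : Type u} [MeasurableSpace X] {μ : Measure X} {q m : ℕ}
    {Θ : Set (Param q)} {p : X → Param q → ℝ} {θ₀ ψ : Param q} {b : ℝ} {A : ℝ≥0}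
    (hA : AssumptionA μ Θ p θ₀ m b ψ A) {c t : ℝ} (hc : 0 ≤ c) (hcb : c < b)
    (ht : t ∈ Icc (0 : ℝ) 1) :
    ∀ᶠ r in nhds t, θ₀ + r • (c • ψ) ∈ Θ ∩ Metric.ball θ₀ b := by
  have hcont : Continuous fun r : ℝ => ‖r • (c • ψ)‖ := by fun_prop
  have hlt : ‖t • (c • ψ)‖ < b := by
    rw [norm_smul, norm_smul, hA.unit, mul_one, Real.norm_of_nonneg ht.1, Real.norm_of_nonneg hc]
    exact (mul_le_of_le_one_left hc ht.2).trans_lt hcb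
  filter_upwards [hcont.continuousAt.eventually_lt continuousAt_const hlt] with r hr
  refine ⟨hA.mem _ ?_ hr, by simpa [mem_ball_iff_norm] using hr⟩
  exact Submodule.smul_mem _ _ (Submodule.smul_mem _ _ (Submodule.mem_span_singleton_self ψ))

/-- `R i` is the integral Taylor remainder at the node `i`; the Taylor polynomials cancel in the
alternating sum. In the constant, `(m * ε) ^ (2 * m)` comes from the length `iε ≤ mε` of the step,
one factor `q ^ m` from Cauchy–Schwarz over index tuples and another from the number of tuples. -/
theorem AssumptionA.exists_remainder {X : Type u} [MeasurableSpace X] {μ : Measure X} {q m : ℕ}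
    {Θ : Set (Param q)} {p : X → Param q → ℝ} {θ₀ ψ : Param q} {b : ℝ} {A : ℝ≥0}
    (hA : AssumptionA μ Θ p θ₀ m b ψ A) (hp : IsDensityFamily μ Θ p) (hm : 1 ≤ m)
    {ε : ℝ} (hε : 0 < ε) (hεb : m * ε < b) :
    ∃ R : ℕ → X → ℝ, (∀ i ∈ Finset.range (m + 1), AEMeasurable (R i) μ) ∧
      (∀ᵐ x ∂μ, ∑ i ∈ Finset.range (m + 1),
          (-1 : ℝ) ^ i * m.choose i * p x (θ₀ + (i * ε) • ψ) =
        ∑ i ∈ Finset.range (m + 1), (-1 : ℝ) ^ i * m.choose i * R i x) ∧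
      ∀ i ∈ Finset.range (m + 1),
        ∫⁻ x, ENNReal.ofReal (R i x ^ 2) / ENNReal.ofReal (p x (θ₀ + (i * ε) • ψ)) ∂μ ≤
          ENNReal.ofReal ((m * ε * q) ^ (2 * m) * A) := by
  obtain ⟨M, rfl⟩ : ∃ M, m = M + 1 := ⟨m - 1, by omega⟩
  obtain ⟨D, hD, hDb⟩ := hA.bound
  have hi0 : ∀ i : ℕ, 0 ≤ i * ε := fun i => by positivity
  have hib : ∀ i ∈ Finset.range (M + 1 + 1), (i : ℝ) * ε ≤ ((M + 1 : ℕ) : ℝ) * ε := fun i hi => by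
    have : i ≤ M + 1 := Nat.lt_succ_iff.1 (Finset.mem_range.1 hi)
    gcongr
  have hspan : ∀ c : ℝ, c • ψ ∈ Submodule.span ℝ {ψ} := fun c =>
    Submodule.smul_mem _ _ (Submodule.mem_span_singleton_self ψ)
  have hnorm : ∀ i : ℕ, ‖((i : ℝ) * ε) • ψ‖ = i * ε := fun i => by
    rw [norm_smul, hA.unit, mul_one, Real.norm_of_nonneg (hi0 i)]
  set h : ℕ → ℕ → ℝ → X → ℝ := fun i j t x =>
    D x (θ₀ + t • ((i * ε) • ψ)) j fun _ => (i * ε) • ψ with hh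
  have hDi : ∀ i ∈ Finset.range (M + 1 + 1), ∀ (k : Fin (M + 1) → Fin q), ∀ t ∈ Icc (0 : ℝ) 1, _ :=
    fun i hi k t ht => hDb k _ (hspan (i * ε))
      (by rw [hnorm]; exact (hib i hi).trans_lt hεb) t ht
  have hcont : ∀ i ∈ Finset.range (M + 1 + 1), ∀ᵐ x ∂μ,
      ContinuousOn (fun t => (1 - t) ^ M / M.factorial * h i (M + 1) t x) (Icc 0 1) := by
    intro i hi
    filter_upwards [hD] with x hx
    have hline : ContinuousOn (fun t : ℝ => D x (θ₀ + t • ((i * ε) • ψ)) (M + 1)) (Icc 0 1) :=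
      (hx.cont (M + 1) le_rfl).comp (by fun_prop) fun t ht =>
        (hA.eventually_line_mem (hi0 i) ((hib i hi).trans_lt hεb) ht).self_of_nhds
    exact ContinuousOn.mul (by fun_prop)
      ((ContinuousMultilinearMap.apply ℝ (fun _ : Fin (M + 1) => Param q) ℝ
        (fun _ => ((i : ℝ) * ε) • ψ)).continuous.comp_continuousOn hline)
  have hmeas : ∀ i ∈ Finset.range (M + 1 + 1), ∀ t ∈ Icc (0 : ℝ) 1,
      AEMeasurable (fun x => (1 - t) ^ M / M.factorial * h i (M + 1) t x) μ := by
    intro i hi t ht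
    refine AEMeasurable.const_mul ?_ _
    simp only [hh, multilinear_diagonal_eq_sum]
    exact Finset.aemeasurable_fun_sum _ fun k _ => (hDi i hi k t ht).1.const_mul _
  refine ⟨fun i x => ∫ t in (0 : ℝ)..1, (1 - t) ^ M / M.factorial * h i (M + 1) t x,
    fun i hi => aemeasurable_intervalIntegral_of_continuousOn (hcont i hi) (hmeas i hi), ?_, ?_⟩
  · filter_upwards [hD] with x hx
    have hmem : ∀ i ∈ Finset.range (M + 1 + 1), ∀ t ∈ Icc (0 : ℝ) 1,
        ∀ᶠ r in nhds t, θ₀ + r • ((i * ε) • ψ) ∈ Θ ∩ Metric.ball θ₀ b := fun i hi t ht =>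
      hA.eventually_line_mem (hi0 i) ((hib i hi).trans_lt hεb) ht
    -- By homogeneity the `j`-th Taylor term at the node `i` is `i ^ j` times a quantity free of
    -- `i`, which the alternating sum annihilates.
    have htay : ∀ i ∈ Finset.range (M + 1 + 1), p x (θ₀ + (i * ε) • ψ) =
        ∑ j ∈ Finset.range (M + 1), (i : ℝ) ^ j * ((D x θ₀ j fun _ => ε • ψ) / j.factorial) +
          ∫ t in (0 : ℝ)..1, (1 - t) ^ M / M.factorial * h i (M + 1) t x := by
      intro i hi
      have := taylor_integral_of_hasDerivAt_chain (m := M) (h := fun j t => h i j t x)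
        (fun j hj t ht => hx.hasDerivAt_line (by omega) (hmem i hi t ht)) ?_
      · have h0 : h i 0 1 x = p x (θ₀ + (i * ε) • ψ) := by
          rw [← hx.zero_eq _ (by simpa using (hmem i hi 1 (by simp)).self_of_nhds)]
          simp only [hh, one_smul, ContinuousMultilinearMap.curry0]
          congr 1
          exact Subsingleton.elim _ _
        rw [h0] at this
        rw [this]
        congr 1
        refine Finset.sum_congr rfl fun j _ => ?_
        simp only [hh, zero_smul, add_zero, mul_smul]
        rw [(D x θ₀ j).map_smul_univ (fun _ => (i : ℝ)) (fun _ => ε • ψ)]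
        simp [mul_div_assoc]
      · have hcont := hx.cont (M + 1) le_rfl
        have hline : ContinuousOn (fun t : ℝ => D x (θ₀ + t • ((i * ε) • ψ)) (M + 1)) (Icc 0 1) :=
          hcont.comp (by fun_prop) fun t ht => (hmem i hi t ht).self_of_nhds
        exact (ContinuousMultilinearMap.apply ℝ (fun _ : Fin (M + 1) => Param q) ℝ
          (fun _ => ((i : ℝ) * ε) • ψ)).continuous.comp_continuousOn hline
    rw [Finset.sum_congr rfl fun i hi => by rw [htay i hi, mul_add], Finset.sum_add_distrib]
    simp only [Finset.mul_sum]
    rw [Finset.sum_comm, Finset.sum_eq_zero, zero_add]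
    intro j hj
    simp only [← mul_assoc]
    rw [← Finset.sum_mul, sum_alternating_choose_mul_pow (Finset.mem_range.1 hj), zero_mul]
  · intro i hi
    have hθ : θ₀ + (i * ε) • ψ ∈ Θ := hA.mem _ (hspan _) (by
      rw [hnorm]; exact (hib i hi).trans_lt hεb)
    have hgm : AEMeasurable (fun x => ENNReal.ofReal (p x (θ₀ + (i * ε) • ψ))) μ :=
      (hp.measurable _ hθ).ennreal_ofReal.aemeasurable
    refine lintegral_sq_intervalIntegral_div_le
      (h := fun t x => (1 - t) ^ M / M.factorial * h i (M + 1) t x) hgm ?_ ?_ ?_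
    · exact hcont i hi
    · exact hmeas i hi
    · intro t ht
      have hpt : ∀ x, ENNReal.ofReal (((1 - t) ^ M / M.factorial * h i (M + 1) t x) ^ 2) /
          ENNReal.ofReal (p x (θ₀ + (i * ε) • ψ)) ≤
          ENNReal.ofReal ((((M + 1 : ℕ) : ℝ) * ε) ^ (2 * (M + 1)) * (q : ℝ) ^ (M + 1)) *
          ∑ k : Fin (M + 1) → Fin q, ENNReal.ofReal
            ((D x (θ₀ + t • ((i * ε) • ψ)) (M + 1) fun j => EuclideanSpace.single (k j) 1) ^ 2) /
              ENNReal.ofReal (p x (θ₀ + (i * ε) • ψ)) := by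
        intro x
        rw [← Finset.sum_congr rfl fun k _ => (div_eq_mul_inv _ _).symm, ← Finset.sum_mul,
          ← mul_assoc, ← div_eq_mul_inv,
          ← ENNReal.ofReal_sum_of_nonneg fun _ _ => sq_nonneg _, ← ENNReal.ofReal_mul (by positivity)]
        gcongr
        have hw : ((1 - t) ^ M / (M.factorial : ℝ)) ^ 2 ≤ 1 := by
          have h0 : 0 ≤ (1 - t) ^ M / (M.factorial : ℝ) :=
            div_nonneg (pow_nonneg (by linarith [ht.2]) _) (by positivity)
          refine pow_le_one₀ h0 ((div_le_one (by positivity)).2 ?_)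
          calc (1 - t) ^ M ≤ 1 := pow_le_one₀ (by linarith [ht.2]) (by linarith [ht.1])
            _ ≤ _ := by exact_mod_cast Nat.factorial_pos M
        calc _ = ((1 - t) ^ M / (M.factorial : ℝ)) ^ 2 * h i (M + 1) t x ^ 2 := by ring
          _ ≤ h i (M + 1) t x ^ 2 := mul_le_of_le_one_left (sq_nonneg _) hw
          _ ≤ _ := sq_multilinear_diagonal_le _ _
          _ ≤ _ := by
            rw [← mul_assoc, hnorm]
            have := hib i hi
            have := hi0 i
            gcongr
      calc _ ≤ _ := lintegral_mono hpt
        _ = ENNReal.ofReal ((((M + 1 : ℕ) : ℝ) * ε) ^ (2 * (M + 1)) * (q : ℝ) ^ (M + 1)) *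
          ∑ k : Fin (M + 1) → Fin q, ∫⁻ x, ENNReal.ofReal
            ((D x (θ₀ + t • ((i * ε) • ψ)) (M + 1) fun j => EuclideanSpace.single (k j) 1) ^ 2) /
              ENNReal.ofReal (p x (θ₀ + (i * ε) • ψ)) ∂μ := by
            rw [lintegral_const_mul' _ _ ENNReal.ofReal_ne_top]
            congr 1
            exact lintegral_finsetSum' _ fun k _ =>
              ((hDi i hi k t ht).1.pow_const 2).ennreal_ofReal.div hgm
        _ ≤ ENNReal.ofReal ((((M + 1 : ℕ) : ℝ) * ε) ^ (2 * (M + 1)) * (q : ℝ) ^ (M + 1)) *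
          ∑ k : Fin (M + 1) → Fin q, (A : ℝ≥0∞) := by
            gcongr with k
            exact (hDi i hi k t ht).2
        _ = _ := by
            rw [Finset.sum_const, Finset.card_univ, nsmul_eq_mul]
            simp only [Fintype.card_pi, Fintype.card_fin, Finset.prod_const, Finset.card_univ]
            rw [← ENNReal.ofReal_natCast, ← ENNReal.ofReal_coe_nnreal,
              ← ENNReal.ofReal_mul (by positivity), ← ENNReal.ofReal_mul (by positivity)]
            congr 1
            rw [mul_pow _ (q : ℝ)]
            push_cast
            ring

/-! ### Hellinger affinity and the two-point inequality -/

/-- Tensorization without product densities. Integrating out the last `n` coordinates leaves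
functions of the first coordinate with product at least `c * ρ ^ n`, to which `h` applies again. -/
theorem le_lintegral_mul_lintegral_pi {X : Type*} [MeasurableSpace X] {P Q : Measure X}
    [SigmaFinite P] [SigmaFinite Q] {ρ : ℝ≥0∞}
    (h : ∀ (c : ℝ≥0∞) (u v : X → ℝ≥0∞), Measurable u → Measurable v → (∀ x, c ≤ u x * v x) →
      c * ρ ≤ (∫⁻ x, u x ∂P) * ∫⁻ x, v x ∂Q)
    (n : ℕ) {c : ℝ≥0∞} {u v : (Fin n → X) → ℝ≥0∞} (hu : Measurable u) (hv : Measurable v)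
    (huv : ∀ x, c ≤ u x * v x) :
    c * ρ ^ n ≤ (∫⁻ x, u x ∂Measure.pi fun _ => P) * ∫⁻ x, v x ∂Measure.pi fun _ => Q := by
  induction n generalizing c with
  | zero =>
    simp only [Measure.pi_of_empty _ (Fin.elim0 : Fin 0 → X), lintegral_dirac]
    simpa using huv _
  | succ n ih =>
    have hPm := (measurePreserving_piFinSuccAbove (fun _ : Fin (n + 1) => P) 0).symm
    have hQm := (measurePreserving_piFinSuccAbove (fun _ : Fin (n + 1) => Q) 0).symm
    set e := (MeasurableEquiv.piFinSuccAbove (fun _ : Fin (n + 1) => X) 0).symm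
    rw [← hPm.lintegral_comp hu, ← hQm.lintegral_comp hv]
    have hu' : Measurable fun z => u (e z) := hu.comp e.measurable
    have hv' : Measurable fun z => v (e z) := hv.comp e.measurable
    rw [lintegral_prod _ hu'.aemeasurable, lintegral_prod _ hv'.aemeasurable, pow_succ, ← mul_assoc]
    refine h _ _ _ hu'.lintegral_prod_right' hv'.lintegral_prod_right' fun x => ?_
    exact ih (hu'.comp measurable_prodMk_left) (hv'.comp measurable_prodMk_left) fun y => huv _

/-- From `F - G = (√F - √G)(√F + √G)` and `(√F + √G)² ≥ F + G` one gets `(√F - √G)² ≤ d`. -/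
theorem add_le_two_mul_sqrt_mul_add {F G d : ℝ} (hF : 0 ≤ F) (hG : 0 ≤ G)
    (hd : 0 ≤ d) (h : (F - G) ^ 2 ≤ (F + G) * d) : F + G ≤ 2 * (√F * √G) + d := by
  rcases (add_nonneg hF hG).eq_or_lt with h0 | h0
  · rw [← h0]; positivity
  have hF' := Real.sq_sqrt hF
  have hG' := Real.sq_sqrt hG
  have hf := Real.sqrt_nonneg F
  have hg := Real.sqrt_nonneg G
  have h1 : (F + G) * (√F - √G) ^ 2 ≤ (F + G) * d := by
    refine le_trans ?_ h
    rw [← hF', ← hG']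
    rw [hF', hG']
    have : F - G = (√F - √G) * (√F + √G) := by nlinarith
    rw [this, mul_pow, mul_comm]
    gcongr
    nlinarith [mul_nonneg hf hg]
  have h2 := le_of_mul_le_mul_left h1 h0
  nlinarith

/-- The squared Hellinger affinity bounds `∫ u dP * ∫ v dQ` from below. -/
theorem mul_sq_affinity_le {X : Type*} [MeasurableSpace X] {μ : Measure X} {F G : X → ℝ≥0∞}
    (hF : Measurable F) (hG : Measurable G) {c : ℝ≥0∞} {u v : X → ℝ≥0∞}
    (hu : Measurable u) (hv : Measurable v) (huv : ∀ x, c ≤ u x * v x) :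
    c * (∫⁻ x, (F x * G x) ^ (1 / 2 : ℝ) ∂μ) ^ 2 ≤
      (∫⁻ x, u x ∂μ.withDensity F) * ∫⁻ x, v x ∂μ.withDensity G := by
  rw [lintegral_withDensity_eq_lintegral_mul _ hF hu, lintegral_withDensity_eq_lintegral_mul _ hG hv]
  have hsq : ∀ y : ℝ≥0∞, (y ^ (1 / 2 : ℝ)) ^ 2 = y := fun y => by
    rw [← ENNReal.rpow_two, ← ENNReal.rpow_mul]; norm_num
  -- Cauchy–Schwarz for `√(F u)` and `√(G v)`, whose product dominates `√c √(F G)`.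
  have hhol := ENNReal.lintegral_mul_le_Lp_mul_Lq μ (p := 2) (q := 2) .two_two
    (f := fun x => (F x * u x) ^ (1 / 2 : ℝ)) (g := fun x => (G x * v x) ^ (1 / 2 : ℝ))
    ((hF.mul hu).pow_const _).aemeasurable ((hG.mul hv).pow_const _).aemeasurable
  simp only [ENNReal.rpow_two, hsq, Pi.mul_apply] at hhol
  have hle : c ^ (1 / 2 : ℝ) * ∫⁻ x, (F x * G x) ^ (1 / 2 : ℝ) ∂μ ≤
      (∫⁻ x, F x * u x ∂μ) ^ (1 / 2 : ℝ) * (∫⁻ x, G x * v x ∂μ) ^ (1 / 2 : ℝ) := by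
    refine le_trans ?_ hhol
    rw [← lintegral_const_mul _ (by fun_prop)]
    refine lintegral_mono fun x => ?_
    rw [← ENNReal.mul_rpow_of_nonneg _ _ (by norm_num), ← ENNReal.mul_rpow_of_nonneg _ _ (by norm_num)]
    refine ENNReal.rpow_le_rpow ?_ (by norm_num)
    calc c * (F x * G x) ≤ u x * v x * (F x * G x) := by gcongr; exact huv x
      _ = _ := by ring
  have := pow_le_pow_left' hle 2
  simpa only [mul_pow, hsq, Pi.mul_apply] using this

/-- Two-point lower bound with separated measurable losses. -/
theorem half_separation_le_of_two_point {Z : Type*} [MeasurableSpace Z] {P Q : Measure Z}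
    [IsProbabilityMeasure P] [IsProbabilityMeasure Q] {r s R : ℝ≥0∞}
    (h : ∀ (c : ℝ≥0∞) (u v : Z → ℝ≥0∞), Measurable u → Measurable v → (∀ x, c ≤ u x * v x) →
      c * r ≤ (∫⁻ x, u x ∂P) * ∫⁻ x, v x ∂Q)
    (hr : 3 / 4 ≤ r) (hs : s ≠ ∞) {u v : Z → ℝ≥0∞} (hu : Measurable u) (hv : Measurable v)
    (huv : ∀ x, 2 * s ≤ u x + v x) (huR : ∫⁻ x, u x ∂P ≤ R) (hvR : ∫⁻ x, v x ∂Q ≤ R) :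
    s / 2 ≤ R := by
  -- The shift by `s` turns a bound on the sum into one on the product: `(u + s)(v + s) ≥ s(u + v) +
  -- s² ≥ 3s²`. With `r ≥ 3/4` this yields `(3s/2)² ≤ (R + s)²`.
  have h1 := h (3 * s ^ 2) (fun x => u x + s) (fun x => v x + s) (hu.add_const s) (hv.add_const s)
    fun x => by
      calc 3 * s ^ 2 = s * (2 * s) + s ^ 2 := by ring
        _ ≤ s * (u x + v x) + s ^ 2 := by gcongr; exact huv x
        _ ≤ u x * v x + (s * (u x + v x) + s ^ 2) := le_add_self
        _ = _ := by ring
  rw [lintegral_add_right _ measurable_const, lintegral_add_right _ measurable_const] at h1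
  simp only [lintegral_const, measure_univ, mul_one] at h1
  have h2 : (s / 2 + s) ^ 2 ≤ (R + s) ^ 2 := by
    calc (s / 2 + s) ^ 2 = 3 * s ^ 2 * (3 / 4) := by
          lift s to ℝ≥0 using hs
          have : ((s : ℝ≥0∞) / 2 + s) ^ 2 = (((s / 2 + s) ^ 2 : ℝ≥0) : ℝ≥0∞) := by
            simp [ENNReal.coe_div]
          rw [this]
          have : 3 * (s : ℝ≥0∞) ^ 2 * (3 / 4) = ((3 * s ^ 2 * (3 / 4) : ℝ≥0) : ℝ≥0∞) := by
            simp [ENNReal.coe_div]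
          rw [this]
          congr 1
          rw [← NNReal.coe_inj]
          push_cast
          ring
      _ ≤ 3 * s ^ 2 * r := by gcongr
      _ ≤ _ := h1
      _ ≤ (R + s) * (R + s) := by gcongr
      _ = _ := by ring
  have h3 : s / 2 + s ≤ R + s := (ENNReal.pow_right_strictMono two_ne_zero).le_iff_le.1 h2
  exact (ENNReal.add_le_add_iff_right hs).1 h3

/-- Cauchy–Schwarz form of the pointwise Hellinger bound, with quotients in `[0, ∞]`. -/
theorem ofReal_add_ofReal_le_affinity_add {s : Finset ℕ} {F G : ℝ} (hF : 0 ≤ F) (hG : 0 ≤ G)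
    {c : ℕ → ℝ≥0} (hc : ∀ i ∈ s, 0 < c i) {σ R P : ℕ → ℝ} (hσ : ∀ i, σ i ^ 2 = 1)
    (hP : ∀ i ∈ s, 0 ≤ P i) (hsub : F - G = ∑ i ∈ s, c i * (σ i * R i))
    (hadd : ∑ i ∈ s, c i * P i ≤ F + G) :
    ENNReal.ofReal F + ENNReal.ofReal G ≤ 2 * (ENNReal.ofReal F * ENNReal.ofReal G) ^ (1 / 2 : ℝ) +
      ∑ i ∈ s, c i * (ENNReal.ofReal (R i ^ 2) / ENNReal.ofReal (P i)) := by
  -- A vanishing denominator under a nonzero remainder makes the right side infinite; otherwise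
  -- everything is a real number.
  by_cases hex : ∃ i ∈ s, P i = 0 ∧ R i ≠ 0
  · obtain ⟨i, hi, hPi, hRi⟩ := hex
    refine le_top.trans (top_le_iff.2 ?_).ge
    refine ENNReal.add_eq_top.2 (Or.inr (ENNReal.sum_eq_top.2 ⟨i, hi, ?_⟩))
    rw [hPi, ENNReal.ofReal_zero, ENNReal.div_zero (by simpa using hRi)]
    exact ENNReal.mul_top (by exact_mod_cast (hc i hi).ne')
  push Not at hex
  have hterm : ∀ i ∈ s, (c i : ℝ≥0∞) * (ENNReal.ofReal (R i ^ 2) / ENNReal.ofReal (P i)) =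
      ENNReal.ofReal (c i * (R i ^ 2 / P i)) := by
    intro i hi
    rw [ENNReal.ofReal_mul (by positivity), ENNReal.ofReal_coe_nnreal]
    congr 1
    rcases (hP i hi).eq_or_lt with h0 | h0
    · simp [← h0, hex i hi h0.symm]
    · rw [ENNReal.ofReal_div_of_pos h0]
  have hnn : ∀ i ∈ s, 0 ≤ c i * (R i ^ 2 / P i) := fun i hi =>
    mul_nonneg (c i).2 (div_nonneg (sq_nonneg _) (hP i hi))
  have hd := Finset.sum_nonneg hnn
  -- Cauchy–Schwarz with weights `c i`, each remainder being paired with the density at its own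
  -- node.
  have hcs : (F - G) ^ 2 ≤ (F + G) * ∑ i ∈ s, c i * (R i ^ 2 / P i) := by
    rw [hsub]
    refine (Finset.sum_sq_le_sum_mul_sum_of_sq_le_mul s (f := fun i => c i * P i)
      (fun i hi => mul_nonneg (c i).2 (hP i hi)) hnn fun i hi => ?_).trans
      (mul_le_mul_of_nonneg_right hadd hd)
    rcases (hP i hi).eq_or_lt with h0 | h0
    · simp [← h0, hex i hi h0.symm]
    · refine le_of_eq ?_
      simp only [mul_pow, hσ]; field_simp
  have key := add_le_two_mul_sqrt_mul_add hF hG hd hcs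
  have haff : (ENNReal.ofReal F * ENNReal.ofReal G) ^ (1 / 2 : ℝ) = ENNReal.ofReal (√F * √G) := by
    rw [← ENNReal.ofReal_mul hF, ENNReal.ofReal_rpow_of_nonneg (mul_nonneg hF hG) (by norm_num),
      ← Real.sqrt_eq_rpow, Real.sqrt_mul hF]
  rw [Finset.sum_congr rfl hterm, ← ENNReal.ofReal_sum_of_nonneg hnn, haff,
    ← ENNReal.ofReal_add hF hG, ← ENNReal.ofReal_ofNat 2, ← ENNReal.ofReal_mul (by norm_num),
    ← ENNReal.ofReal_add (by positivity) hd]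
  exact ENNReal.ofReal_le_ofReal key

/-- Integrating the pointwise bound gives `2 ≤ 2 * BC + 2 * δ`, since both densities have integral
`1` and the weights sum to at most `2`. -/
theorem one_sub_le_affinity {X : Type*} [MeasurableSpace X] {μ : Measure X} {s : Finset ℕ}
    {F G : X → ℝ} (hF : ∀ x, 0 ≤ F x) (hG : ∀ x, 0 ≤ G x) (hFm : Measurable F) (hGm : Measurable G)
    (hF1 : ∫⁻ x, ENNReal.ofReal (F x) ∂μ = 1) (hG1 : ∫⁻ x, ENNReal.ofReal (G x) ∂μ = 1)
    {c : ℕ → ℝ≥0} (hc : ∀ i ∈ s, 0 < c i) (hc2 : ∑ i ∈ s, c i ≤ 2)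
    {σ : ℕ → ℝ} (hσ : ∀ i, σ i ^ 2 = 1) {R P : ℕ → X → ℝ}
    (hRm : ∀ i ∈ s, AEMeasurable (R i) μ) (hPm : ∀ i ∈ s, Measurable (P i))
    (hP : ∀ i ∈ s, ∀ x, 0 ≤ P i x) (hsub : ∀ᵐ x ∂μ, F x - G x = ∑ i ∈ s, c i * (σ i * R i x))
    (hadd : ∀ x, ∑ i ∈ s, c i * P i x ≤ F x + G x) {δ : ℝ} (hδ : 0 ≤ δ)
    (hR : ∀ i ∈ s, ∫⁻ x, ENNReal.ofReal (R i x ^ 2) / ENNReal.ofReal (P i x) ∂μ ≤ ENNReal.ofReal δ) :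
    ENNReal.ofReal (1 - δ) ≤
      ∫⁻ x, (ENNReal.ofReal (F x) * ENNReal.ofReal (G x)) ^ (1 / 2 : ℝ) ∂μ := by
  set BC := ∫⁻ x, (ENNReal.ofReal (F x) * ENNReal.ofReal (G x)) ^ (1 / 2 : ℝ) ∂μ
  have hquot : ∀ i ∈ s,
      AEMeasurable (fun x => ENNReal.ofReal (R i x ^ 2) / ENNReal.ofReal (P i x)) μ := fun i hi =>
    ((hRm i hi).pow_const 2).ennreal_ofReal.div (hPm i hi).ennreal_ofReal.aemeasurable
  have h2 : (2 : ℝ≥0∞) ≤ 2 * (BC + ENNReal.ofReal δ) := by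
    calc (2 : ℝ≥0∞) = ∫⁻ x, ENNReal.ofReal (F x) + ENNReal.ofReal (G x) ∂μ := by
          rw [lintegral_add_left hFm.ennreal_ofReal, hF1, hG1]; norm_num
      _ ≤ ∫⁻ x, 2 * (ENNReal.ofReal (F x) * ENNReal.ofReal (G x)) ^ (1 / 2 : ℝ) +
          ∑ i ∈ s, c i * (ENNReal.ofReal (R i x ^ 2) / ENNReal.ofReal (P i x)) ∂μ := by
          refine lintegral_mono_ae ?_
          filter_upwards [hsub] with x hx
          exact ofReal_add_ofReal_le_affinity_add (hF x) (hG x) hc hσ (fun i hi => hP i hi x) hx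
            (hadd x)
      _ = 2 * BC + ∑ i ∈ s,
          c i * ∫⁻ x, ENNReal.ofReal (R i x ^ 2) / ENNReal.ofReal (P i x) ∂μ := by
          rw [lintegral_add_left (by fun_prop), lintegral_const_mul _ (by fun_prop),
            lintegral_finsetSum' _ fun i hi => (hquot i hi).const_mul _]
          congr 1
          exact Finset.sum_congr rfl fun i hi => lintegral_const_mul' _ _ ENNReal.coe_ne_top
      _ ≤ 2 * BC + ∑ i ∈ s, c i * ENNReal.ofReal δ := by
          gcongr with i hi
          exact hR i hi
      _ ≤ 2 * BC + 2 * ENNReal.ofReal δ := by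
          rw [← Finset.sum_mul]
          gcongr
          exact_mod_cast hc2
      _ = _ := by ring
  have h1 : (1 : ℝ≥0∞) ≤ BC + ENNReal.ofReal δ := by
    rw [← ENNReal.mul_le_mul_iff_right (a := 2) (by norm_num) (by norm_num), mul_one]
    exact h2
  rw [ENNReal.ofReal_sub _ hδ, ENNReal.ofReal_one]
  exact tsub_le_iff_right.2 h1

/-- Bernoulli: `(1 - δ)^(2n) ≥ 1 - 2nδ ≥ 3/4`. -/
theorem three_quarters_le_affinity_pow {n : ℕ} {B : ℝ≥0∞} {δ : ℝ}
    (hn : 8 * n * δ ≤ 1) (hn1 : 1 ≤ n) (hB : ENNReal.ofReal (1 - δ) ≤ B) :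
    3 / 4 ≤ (B ^ 2) ^ n := by
  have hn1' : (1 : ℝ) ≤ n := by exact_mod_cast hn1
  have hδ1 : δ ≤ 1 := by nlinarith
  have hbern := one_add_mul_le_pow (a := -δ) (by linarith) (2 * n)
  have : (3 / 4 : ℝ≥0∞) = ENNReal.ofReal (3 / 4) := by
    rw [ENNReal.ofReal_div_of_pos (by norm_num)]; norm_num
  rw [← pow_mul, this]
  refine le_trans ?_ (pow_le_pow_left' hB _)
  rw [← ENNReal.ofReal_pow (by linarith)]
  refine ENNReal.ofReal_le_ofReal ?_
  rw [sub_eq_add_neg]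
  refine le_trans ?_ hbern
  push_cast
  linarith

/-! ### Binomial weights on even and odd nodes -/

open Finset in
theorem sum_choose_even_odd {m : ℕ} (hm : 1 ≤ m) :
    ∑ i ∈ range (m + 1) with Even i, (m.choose i : ℝ≥0) = 2 ^ (m - 1) ∧
      ∑ i ∈ range (m + 1) with ¬ Even i, (m.choose i : ℝ≥0) = 2 ^ (m - 1) := by
  have h1 : ∑ i ∈ range (m + 1), (-1 : ℝ) ^ i * m.choose i = 0 := by
    simpa using sum_alternating_choose_mul_pow (m := m) (j := 0) hm
  have h2 : ∑ i ∈ range (m + 1), (m.choose i : ℝ) = 2 ^ m := by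
    exact_mod_cast Nat.sum_range_choose m
  rw [← sum_filter_add_sum_filter_not _ (fun i => Even i)] at h1 h2
  have he : ∑ i ∈ range (m + 1) with Even i, (-1 : ℝ) ^ i * m.choose i =
      ∑ i ∈ range (m + 1) with Even i, (m.choose i : ℝ) :=
    sum_congr rfl fun i hi => by rw [(mem_filter.1 hi).2.neg_one_pow, one_mul]
  have ho : ∑ i ∈ range (m + 1) with ¬ Even i, (-1 : ℝ) ^ i * m.choose i =
      -∑ i ∈ range (m + 1) with ¬ Even i, (m.choose i : ℝ) := by
    rw [← sum_neg_distrib]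
    exact sum_congr rfl fun i hi => by
      rw [(Nat.not_even_iff_odd.1 (mem_filter.1 hi).2).neg_one_pow]; ring
  rw [he, ho] at h1
  obtain ⟨M, rfl⟩ : ∃ M, m = M + 1 := ⟨m - 1, by omega⟩
  rw [pow_succ] at h2
  simp only [Nat.add_sub_cancel]
  constructor <;> rw [← NNReal.coe_inj] <;> push_cast <;> linarith

open Finset in
theorem card_filter_even_odd (d : ℕ) :
    #{i ∈ range (2 * d) | Even i} = d ∧ #{i ∈ range (2 * d) | ¬ Even i} = d := by
  have he : #{i ∈ range (2 * d) | Even i} = d := by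
    induction d with
    | zero => simp
    | succ d ih =>
      rw [show 2 * (d + 1) = 2 * d + 1 + 1 by ring, range_add_one, range_add_one]
      simp [filter_insert, ih]
  have := card_filter_add_card_filter_not (s := range (2 * d)) (fun i => Even i)
  rw [card_range] at this
  exact ⟨he, by omega⟩

/-! ### Wasserstein distance and finitely supported mixing measures -/

/-- The easy half of Kantorovich duality: integrate the Lipschitz bound against any coupling. -/
theorem lintegral_le_lintegral_add_wasserstein1 {q : ℕ} {Θ : Set (Param q)}
    (P G : ProbabilityMeasure Θ) {f : Θ → ℝ≥0∞} (hf : Measurable f)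
    (hLip : ∀ x y, f x ≤ f y + edist x y) :
    ∫⁻ θ, f θ ∂(G : Measure Θ) ≤ ∫⁻ θ, f θ ∂(P : Measure Θ) + wasserstein1 P G := by
  rw [wasserstein1]
  simp only [ENNReal.add_iInf]
  refine le_iInf₂ fun π hπ => ?_
  rw [← hπ.1, ← hπ.2, lintegral_map hf measurable_fst, lintegral_map hf measurable_snd,
    ← lintegral_add_left (by fun_prop)]
  refine lintegral_mono fun z => ?_
  rw [edist_comm]
  exact hLip _ _

theorem lintegral_le_lintegral_add_wasserstein1' {q : ℕ} {Θ : Set (Param q)}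
    (P G : ProbabilityMeasure Θ) {f : Θ → ℝ≥0∞} (hf : Measurable f)
    (hLip : ∀ x y, f x ≤ f y + edist x y) :
    ∫⁻ θ, f θ ∂(P : Measure Θ) ≤ ∫⁻ θ, f θ ∂(G : Measure Θ) + wasserstein1 P G := by
  rw [wasserstein1]
  simp only [ENNReal.add_iInf]
  refine le_iInf₂ fun π hπ => ?_
  rw [← hπ.1, ← hπ.2, lintegral_map hf measurable_fst, lintegral_map hf measurable_snd,
    ← lintegral_add_left (by fun_prop)]
  exact lintegral_mono fun z => hLip _ _

/-- Collapsing finitely many atoms into the point `t` moves their mass by at most `r`. -/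
theorem wasserstein1_le_of_eq_add {q : ℕ} {Θ : Set (Param q)} (G H : ProbabilityMeasure Θ)
    {B : Measure Θ} {ι : Type*} {s : Finset ι} {c : ι → ℝ≥0} {x : ι → Θ} {t : Θ}
    (hG : (G : Measure Θ) = B + ∑ i ∈ s, (c i : ℝ≥0∞) • Measure.dirac (x i))
    (hH : (H : Measure Θ) = B + ((∑ i ∈ s, c i : ℝ≥0) : ℝ≥0∞) • Measure.dirac t)
    {r : ℝ≥0∞} (hr : ∀ i ∈ s, edist (x i) t ≤ r) :
    wasserstein1 G H ≤ (∑ i ∈ s, c i : ℝ≥0) * r := by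
  have hdiag : Measurable fun y : Θ => (y, y) := measurable_id.prodMk measurable_id
  -- The coupling leaves the common part `B` in place on the diagonal and sends each `x i` to `t`.
  have hcoupling : B.map (fun y => (y, y)) + ∑ i ∈ s, (c i : ℝ≥0∞) • Measure.dirac (x i, t) ∈
      {π : Measure (Θ × Θ) | π.map Prod.fst = (G : Measure Θ) ∧
        π.map Prod.snd = (H : Measure Θ)} := by
    refine ⟨?_, ?_⟩
    · rw [hG, Measure.map_add _ _ measurable_fst, Measure.map_map measurable_fst hdiag,
        Measure.map_finset_sum measurable_fst.aemeasurable]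
      congr 1
      · exact Measure.map_id
      · refine Finset.sum_congr rfl fun i _ => ?_
        rw [Measure.map_smul, Measure.map_dirac' measurable_fst]
    · rw [hH, Measure.map_add _ _ measurable_snd, Measure.map_map measurable_snd hdiag,
        Measure.map_finset_sum measurable_snd.aemeasurable]
      congr 1
      · exact Measure.map_id
      · rw [ENNReal.ofNNReal_finsetSum, Finset.sum_smul]
        refine Finset.sum_congr rfl fun i _ => ?_
        rw [Measure.map_smul, Measure.map_dirac' measurable_snd]
  refine (iInf₂_le _ hcoupling).trans ?_
  rw [lintegral_add_measure, lintegral_map (measurable_fst.edist measurable_snd) hdiag,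
    lintegral_finsetSum_measure]
  simp only [edist_self, lintegral_zero, zero_add, lintegral_smul_measure, lintegral_dirac,
    smul_eq_mul]
  rw [ENNReal.ofNNReal_finsetSum, Finset.sum_mul]
  exact Finset.sum_le_sum fun i hi => by gcongr; exact hr i hi

theorem MeasureTheory.Measure.eq_sum_dirac_of_compl_finset {Y : Type*} [MeasurableSpace Y]
    [MeasurableSingletonClass Y] {ν : Measure Y} {T : Finset Y} (h : ν (T : Set Y)ᶜ = 0) :
    ν = ∑ t ∈ T, ν {t} • Measure.dirac t := by
  ext s hs
  rw [← measure_inter_add_sdiff s T.measurableSet,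
    measure_mono_null (s := s \ T) (fun _ hx => hx.2) h, add_zero]
  have : s ∩ (T : Set Y) = ⋃ t ∈ T, (s ∩ {t}) := by
    ext y; simp
  rw [this, measure_biUnion_finset (fun a _ b _ hab => ?_) fun t _ => hs.inter (measurableSet_singleton t)]
  · rw [Measure.finsetSum_apply]
    refine Finset.sum_congr rfl fun t _ => ?_
    rw [Measure.smul_apply, smul_eq_mul, Measure.dirac_apply' _ hs]
    by_cases ht : t ∈ s
    · rw [Set.inter_eq_self_of_subset_right (Set.singleton_subset_iff.2 ht)]; simp [ht]
    · rw [Set.inter_singleton_eq_empty.2 ht]; simp [ht]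
  · exact Set.disjoint_left.2 fun y hy hy' => hab (hy.2.symm.trans hy'.2)

/-- Only the size of a carrier is counted, so coinciding atoms are harmless: a node may fall on
another atom of `G₀`. -/
theorem mem_atMostAtoms_of_compl_finset {q k : ℕ} {Θ : Set (Param q)} {G : ProbabilityMeasure Θ}
    {T : Finset Θ} (hT : (G : Measure Θ) (T : Set Θ)ᶜ = 0) (hk : T.card ≤ k) :
    G ∈ atMostAtoms Θ k := by
  classical
  have hsum := Measure.eq_sum_dirac_of_compl_finset hT
  set S := T.filter fun t => G {t} ≠ 0 with hS
  have hS' : (G : Measure Θ) = ∑ t ∈ S, ((G {t} : ℝ≥0) : ℝ≥0∞) • Measure.dirac t := by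
    conv_lhs => rw [hsum]
    simp only [ProbabilityMeasure.ennreal_coeFn_eq_coeFn_toMeasure]
    rw [hS, Finset.sum_filter_of_ne]
    intro t _ ht h0
    apply ht
    rw [← ProbabilityMeasure.ennreal_coeFn_eq_coeFn_toMeasure, h0]
    simp
  refine ⟨S.card, ?_, (Finset.card_filter_le _ _).trans hk, fun i => S.equivFin.symm i,
    fun i => G {(S.equivFin.symm i : Θ)}, ?_, ?_, ?_⟩
  · rw [Nat.one_le_iff_ne_zero, Ne, Finset.card_eq_zero]
    intro h0
    rw [h0, Finset.sum_empty] at hS'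
    exact IsProbabilityMeasure.ne_zero (G : Measure Θ) hS'
  · exact Subtype.val_injective.comp S.equivFin.symm.injective
  · intro i
    exact pos_iff_ne_zero.2 (Finset.mem_filter.1 (S.equivFin.symm i).2).2
  · rw [Equiv.sum_comp S.equivFin.symm fun t : S => ((G {(t : Θ)} : ℝ≥0) : ℝ≥0∞) • Measure.dirac (t : Θ)]
    conv_lhs => rw [hS']
    exact (Finset.sum_coe_sort S fun t => ((G {t} : ℝ≥0) : ℝ≥0∞) • Measure.dirac t).symm

/-- Splitting off one atom. -/
theorem exists_eq_sum_add_smul_dirac {q k : ℕ} {Θ : Set (Param q)} {G : ProbabilityMeasure Θ}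
    (hG : G ∈ exactlyAtoms Θ k) {t : Θ} (ht : G {t} ≠ 0) :
    ∃ (T : Finset Θ) (v : Θ → ℝ≥0), T.card + 1 ≤ k ∧
      (G : Measure Θ) = ∑ y ∈ T, (v y : ℝ≥0∞) • Measure.dirac y + (G {t} : ℝ≥0∞) • Measure.dirac t := by
  classical
  obtain ⟨θ, w, hθ, hw, hsum⟩ := hG
  have hT : (G : Measure Θ) (Finset.univ.image θ : Set Θ)ᶜ = 0 := by
    rw [hsum, Measure.finsetSum_apply]
    refine Finset.sum_eq_zero fun i _ => ?_
    rw [Measure.smul_apply, Measure.dirac_apply' _ (Finset.measurableSet _).compl]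
    simp
  have hmem : t ∈ Finset.univ.image θ := by
    by_contra hn
    apply ht
    rw [← ENNReal.coe_eq_zero, ProbabilityMeasure.ennreal_coeFn_eq_coeFn_toMeasure]
    refine measure_mono_null ?_ hT
    simpa using hn
  refine ⟨(Finset.univ.image θ).erase t, fun y => G {y}, ?_, ?_⟩
  · rw [Finset.card_erase_add_one hmem, Finset.card_image_of_injective _ hθ]
    simp
  · simp only [ProbabilityMeasure.ennreal_coeFn_eq_coeFn_toMeasure]
    rw [Finset.sum_erase_add _ _ hmem]
    exact Measure.eq_sum_dirac_of_compl_finset hT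

/-- Mixture densities of finitely supported mixing measures, written as real-valued functions. -/
theorem lintegral_ofReal_sum_dirac {Y ι : Type*} [MeasurableSpace Y] [MeasurableSingletonClass Y]
    {s : Finset ι} {c : ι → ℝ≥0} {x : ι → Y} {f : Y → ℝ} (hf : ∀ y, 0 ≤ f y) :
    ∫⁻ y, ENNReal.ofReal (f y) ∂(∑ i ∈ s, (c i : ℝ≥0∞) • Measure.dirac (x i)) =
      ENNReal.ofReal (∑ i ∈ s, c i * f (x i)) := by
  rw [lintegral_finsetSum_measure,
    ENNReal.ofReal_sum_of_nonneg (f := fun i => (c i : ℝ) * f (x i))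
      fun i _ => mul_nonneg (c i).2 (hf _)]
  refine Finset.sum_congr rfl fun i _ => ?_
  rw [lintegral_smul_measure, lintegral_dirac, ENNReal.ofReal_mul (by positivity)]
  simp

theorem isProbabilityMeasure_mixture {X : Type u} [MeasurableSpace X] {q : ℕ} {μ : Measure X}
    {Θ : Set (Param q)} {p : X → Param q → ℝ} (hp : IsDensityFamily μ Θ p)
    {G : ProbabilityMeasure Θ} {T : Finset Θ} (hT : (G : Measure Θ) (T : Set Θ)ᶜ = 0) :
    IsProbabilityMeasure (mixture μ p G) := by
  constructor
  have hG := Measure.eq_sum_dirac_of_compl_finset hT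
  have h1 : (G : Measure Θ) univ = 1 := measure_univ
  rw [hG, Measure.finsetSum_apply] at h1
  simp only [Measure.smul_apply, measure_univ, smul_eq_mul, mul_one] at h1
  rw [mixture, withDensity_apply _ MeasurableSet.univ, Measure.restrict_univ, hG]
  simp only [lintegral_finsetSum_measure, lintegral_smul_measure, lintegral_dirac, smul_eq_mul]
  rw [lintegral_finsetSum _ fun t _ => ((hp.measurable _ t.2).ennreal_ofReal.const_mul _), ← h1]
  refine Finset.sum_congr rfl fun t _ => ?_
  rw [lintegral_const_mul' _ _ (measure_ne_top _ _), hp.lintegral_eq_one _ t.2, mul_one]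

/-! ### The minimax lower bound -/

/-- The two-point method in the form used for the minimax risk: a bounded Lipschitz statistic
separates the two mixing measures. -/
theorem half_separation_le_minimaxRisk {X : Type u} [MeasurableSpace X] {q : ℕ} {μ : Measure X}
    {Θ : Set (Param q)} {p : X → Param q → ℝ} {n : ℕ} {S : Set (ProbabilityMeasure Θ)}
    {G H : ProbabilityMeasure Θ} (hG : G ∈ S) (hH : H ∈ S)
    [IsProbabilityMeasure (mixture μ p G)] [IsProbabilityMeasure (mixture μ p H)] {ρ s : ℝ≥0∞}
    (hρ : ∀ (c : ℝ≥0∞) (u v : X → ℝ≥0∞), Measurable u → Measurable v → (∀ x, c ≤ u x * v x) →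
      c * ρ ≤ (∫⁻ x, u x ∂mixture μ p G) * ∫⁻ x, v x ∂mixture μ p H)
    (hρn : 3 / 4 ≤ ρ ^ n) (hs : s ≠ ∞) {f : Θ → ℝ≥0∞} (hf : Measurable f)
    (hLip : ∀ x y, f x ≤ f y + edist x y) (hfH : ∫⁻ θ, f θ ∂(H : Measure Θ) ≠ ∞)
    (hsep : ∫⁻ θ, f θ ∂(G : Measure Θ) = ∫⁻ θ, f θ ∂(H : Measure Θ) + 2 * s) :
    s / 2 ≤ minimaxRisk μ p n S := by
  refine le_iInf₂ fun est hest => ?_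
  have hφ : Measurable fun x => ∫⁻ θ, f θ ∂(est x : Measure Θ) :=
    (Measure.measurable_lintegral hf).comp (measurable_subtype_coe.comp hest)
  set gG := ∫⁻ θ, f θ ∂(G : Measure Θ)
  set gH := ∫⁻ θ, f θ ∂(H : Measure Θ)
  -- The truncated differences are measurable in the sample, are dominated by the two `W₁` losses,
  -- and sum to at least `gG - gH = 2 * s`.
  refine half_separation_le_of_two_point (P := Measure.pi fun _ : Fin n => mixture μ p G)
    (Q := Measure.pi fun _ : Fin n => mixture μ p H) (r := ρ ^ n)
    (u := fun x => gG - ∫⁻ θ, f θ ∂(est x : Measure Θ))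
    (v := fun x => ∫⁻ θ, f θ ∂(est x : Measure Θ) - gH)
    (fun c u v hu hv huv => le_lintegral_mul_lintegral_pi hρ n hu hv huv) hρn hs
    (measurable_const.sub hφ) (hφ.sub measurable_const) (fun x => ?_) ?_ ?_
  · calc 2 * s = gG - gH := by rw [hsep, ENNReal.add_sub_cancel_left hfH]
      _ ≤ _ := tsub_le_tsub_add_tsub
  · refine le_trans (lintegral_mono fun x => ?_) (le_iSup₂ (f := fun G (_ : G ∈ S) =>
      ∫⁻ x, wasserstein1 (est x) G ∂(Measure.pi fun _ : Fin n => mixture μ p G)) G hG)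
    exact tsub_le_iff_left.2 (lintegral_le_lintegral_add_wasserstein1 _ _ hf hLip)
  · refine le_trans (lintegral_mono fun x => ?_) (le_iSup₂ (f := fun G (_ : G ∈ S) =>
      ∫⁻ x, wasserstein1 (est x) G ∂(Measure.pi fun _ : Fin n => mixture μ p G)) H hH)
    exact tsub_le_iff_left.2 (lintegral_le_lintegral_add_wasserstein1' _ _ hf hLip)

/-- The construction at a fixed scale `ε`: `hεb` keeps all nodes within the radius, and `hεn` keeps
the `n`-fold squared affinity above `3/4`. -/
theorem ofReal_le_minimaxRisk_of_assumptionA {X : Type u} [MeasurableSpace X] {q d k₀ k n : ℕ}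
    {μ : Measure X} {Θ : Set (Param q)} {p : X → Param q → ℝ} (hp : IsDensityFamily μ Θ p)
    (hd : 1 ≤ d) (hk : k₀ + d ≤ k + 1) {G₀ : ProbabilityMeasure Θ} (hG₀ : G₀ ∈ exactlyAtoms Θ k₀)
    {θ₀ : Θ} (hw : G₀ {θ₀} ≠ 0) {ψ : Param q} {b : ℝ} {A : ℝ≥0}
    (hA : AssumptionA μ Θ p θ₀ (2 * d - 1) b ψ A) {ε : ℝ} (hε : 0 < ε)
    (hεb : ((2 * d - 1 : ℕ) : ℝ) * ε < b) (hn : 1 ≤ n)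
    (hεn : 8 * n * ((((2 * d - 1 : ℕ) : ℝ) * ε * q) ^ (2 * (2 * d - 1)) * A) ≤ 1)
    {S : Set (ProbabilityMeasure Θ)} (hS : ∀ G ∈ atMostAtoms Θ k,
      wasserstein1 G G₀ ≤ ENNReal.ofReal (((2 * d - 1 : ℕ) : ℝ) * ε) → G ∈ S) :
    ENNReal.ofReal (G₀ {θ₀} * ε / 2 ^ (2 * d)) ≤ minimaxRisk μ p n S := by
  classical
  obtain ⟨T, v, hT, hdec⟩ := exists_eq_sum_add_smul_dirac hG₀ hw
  set w : ℝ≥0 := G₀ {θ₀} with hwdef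
  set m := 2 * d - 1 with hm
  have hm1 : 1 ≤ m := by omega
  have hw1 : w ≤ 1 := ProbabilityMeasure.apply_le_one _ _
  have hwpos : 0 < w := pos_iff_ne_zero.2 hw
  -- Even and odd binomial coefficients both sum to `2 ^ (m - 1)`, so each parity class carries
  -- exactly the mass `w`.
  set c : ℕ → ℝ≥0 := fun i => w / 2 ^ (m - 1) * m.choose i with hc
  have hnode : ∀ i ∈ Finset.range (m + 1), (θ₀ : Param q) + ((i : ℝ) * ε) • ψ ∈ Θ := fun i hi => by
    have := (hA.eventually_line_mem (c := i * ε) (t := 1) (by positivity)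
      (lt_of_le_of_lt ?_ hεb) (by simp)).self_of_nhds
    · simpa using this.1
    · have : i ≤ m := Nat.lt_succ_iff.1 (Finset.mem_range.1 hi)
      gcongr
  obtain ⟨ϑ, hϑ⟩ : ∃ ϑ : ℕ → Θ, ∀ i ∈ Finset.range (m + 1),
      (ϑ i : Param q) = (θ₀ : Param q) + ((i : ℝ) * ε) • ψ :=
    ⟨fun i => if h : (θ₀ : Param q) + ((i : ℝ) * ε) • ψ ∈ Θ then ⟨_, h⟩ else θ₀, fun i hi => by
      simp [hnode i hi]⟩
  have hdist : ∀ i ∈ Finset.range (m + 1), edist (ϑ i) θ₀ = ENNReal.ofReal (i * ε) := fun i hi => by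
    rw [Subtype.edist_eq, hϑ i hi, edist_eq_enorm_sub, add_sub_cancel_left, ← ofReal_norm,
      norm_smul, hA.unit, mul_one, Real.norm_of_nonneg (by positivity)]
  set B : Measure Θ := ∑ y ∈ T, (v y : ℝ≥0∞) • Measure.dirac y with hB
  set M : Finset ℕ → Measure Θ := fun s => B + ∑ i ∈ s, (c i : ℝ≥0∞) • Measure.dirac (ϑ i) with hM
  set F : Finset ℕ → X → ℝ := fun s x => ∑ y ∈ T, v y * p x y + ∑ i ∈ s, c i * p x (ϑ i) with hF
  have hpnn : ∀ x (y : Θ), 0 ≤ p x y := fun x y => hp.nonneg _ y.2 x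
  have hFnn : ∀ s x, 0 ≤ F s x := fun s x => add_nonneg
    (Finset.sum_nonneg fun y _ => mul_nonneg (v y).2 (hpnn x y))
    (Finset.sum_nonneg fun i _ => mul_nonneg (c i).2 (hpnn x _))
  have hpm : ∀ y : Θ, Measurable fun x => p x y := fun y => hp.measurable _ y.2
  have hFm : ∀ s, Measurable (F s) := fun s =>
    (Finset.measurable_fun_sum _ fun y _ => (hpm y).const_mul _).add
      (Finset.measurable_fun_sum _ fun i _ => (hpm _).const_mul _)
  have hmix : ∀ s ⊆ Finset.range (m + 1), ∑ i ∈ s, c i = w → s.card = d →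
      ∃ G : ProbabilityMeasure Θ, (G : Measure Θ) = M s ∧ G ∈ S ∧
        mixture μ p G = μ.withDensity (fun x => ENNReal.ofReal (F s x)) ∧
        ∫⁻ x, ENNReal.ofReal (F s x) ∂μ = 1 ∧ IsProbabilityMeasure (mixture μ p G) := by
    intro s hs hsw hsd
    have hprob : IsProbabilityMeasure (M s) := by
      constructor
      have h1 : (G₀ : Measure Θ) univ = 1 := measure_univ
      rw [hdec, Measure.add_apply] at h1
      rw [← h1, hM, ← hsw]
      simp
    have hnull : M s ((T ∪ s.image ϑ : Finset Θ) : Set Θ)ᶜ = 0 := by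
      simp only [hM, hB, Measure.add_apply, Measure.finsetSum_apply, Measure.smul_apply,
        Measure.dirac_apply' _ (Finset.measurableSet _).compl, smul_eq_mul]
      rw [Finset.sum_eq_zero, Finset.sum_eq_zero, add_zero]
      · intro i hi
        rw [indicator_of_notMem, mul_zero]
        exact fun h => h (Finset.mem_coe.2
          (Finset.mem_union_right _ (Finset.mem_image_of_mem ϑ hi)))
      · intro y hy
        rw [indicator_of_notMem, mul_zero]
        exact fun h => h (Finset.mem_coe.2 (Finset.mem_union_left _ hy))
    have hdens : mixture μ p ⟨M s, hprob⟩ = μ.withDensity fun x => ENNReal.ofReal (F s x) := by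
      refine congrArg μ.withDensity (funext fun x => ?_)
      change ∫⁻ y : Θ, ENNReal.ofReal (p x y) ∂(M s) = _
      simp only [hM]
      rw [lintegral_add_measure, hB, lintegral_ofReal_sum_dirac (f := fun y : Θ => p x y) (hpnn x),
        lintegral_ofReal_sum_dirac (f := fun y : Θ => p x y) (hpnn x), ← ENNReal.ofReal_add]
      · exact Finset.sum_nonneg fun y _ => mul_nonneg (v y).2 (hpnn x y)
      · exact Finset.sum_nonneg fun i _ => mul_nonneg (c i).2 (hpnn x _)
    have hmprob : IsProbabilityMeasure (mixture μ p ⟨M s, hprob⟩) :=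
      isProbabilityMeasure_mixture hp hnull
    refine ⟨⟨M s, hprob⟩, rfl, hS _ (mem_atMostAtoms_of_compl_finset hnull ?_) ?_, hdens, ?_, hmprob⟩
    -- At most `k₀ - 1` remaining atoms and `d` nodes, which is at most `k`.
    · have h1 := Finset.card_union_le T (s.image ϑ)
      have h2 := Finset.card_image_le (s := s) (f := ϑ)
      omega
    · refine (wasserstein1_le_of_eq_add (B := B) (s := s) (c := c) (x := ϑ) (t := θ₀) _ _ rfl
        (by rw [hsw]; exact hdec) (r := ENNReal.ofReal (m * ε)) fun i hi => ?_).trans ?_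
      · rw [hdist i (hs hi)]
        refine ENNReal.ofReal_le_ofReal ?_
        have : i ≤ m := Nat.lt_succ_iff.1 (Finset.mem_range.1 (hs hi))
        gcongr
      · rw [hsw]
        exact mul_le_of_le_one_left zero_le (by exact_mod_cast hw1)
    · have : mixture μ p ⟨M s, hprob⟩ univ = 1 := measure_univ
      rwa [hdens, withDensity_apply _ MeasurableSet.univ, Measure.restrict_univ] at this
  obtain ⟨hsumE, hsumO⟩ := sum_choose_even_odd hm1
  have hcard := card_filter_even_odd d
  rw [show 2 * d = m + 1 by omega] at hcard
  set E := {i ∈ Finset.range (m + 1) | Even i} with hE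
  set O := {i ∈ Finset.range (m + 1) | ¬ Even i} with hO
  have h2 : (2 : ℝ≥0) ^ (m - 1) ≠ 0 := by positivity
  obtain ⟨G, hGM, hGS, hGd, hG1, hGp⟩ := hmix E (Finset.filter_subset _ _)
    (by simp only [hc]; rw [← Finset.mul_sum, hsumE, div_mul_cancel₀ _ h2]) hcard.1
  obtain ⟨H, hHM, hHS, hHd, hH1, hHp⟩ := hmix O (Finset.filter_subset _ _)
    (by simp only [hc]; rw [← Finset.mul_sum, hsumO, div_mul_cancel₀ _ h2]) hcard.2
  obtain ⟨R, hRm, hReq, hRb⟩ := hA.exists_remainder hp hm1 hε hεb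
  set P : ℕ → X → ℝ := fun i x => p x ((θ₀ : Param q) + ((i : ℝ) * ε) • ψ) with hP
  have haff := one_sub_le_affinity (μ := μ) (s := Finset.range (m + 1)) (F := F E) (G := F O)
    (c := c) (σ := fun i => (-1) ^ i) (R := R) (P := P) (hFnn E) (hFnn O) (hFm E) (hFm O) hG1 hH1
    (fun i hi => by
      have : 0 < m.choose i := Nat.choose_pos (Nat.lt_succ_iff.1 (Finset.mem_range.1 hi))
      positivity)
    (by
      rw [← Finset.sum_filter_add_sum_filter_not _ (fun i => Even i)]
      simp only [hc]
      rw [← Finset.mul_sum, ← Finset.mul_sum, hsumE, hsumO, div_mul_cancel₀ _ h2]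
      calc w + w ≤ 1 + 1 := by gcongr
        _ = 2 := by norm_num)
    (fun i => by rw [← pow_mul, mul_comm, pow_mul]; simp) hRm
    (fun i hi => hp.measurable _ (hnode i hi)) (fun i hi x => hp.nonneg _ (hnode i hi) x)
    (by
      filter_upwards [hReq] with x hx
      have hsplit : F E x - F O x = ∑ i ∈ Finset.range (m + 1), c i * ((-1) ^ i * P i x) := by
        rw [← Finset.sum_filter_add_sum_filter_not _ (fun i => Even i)]
        simp only [hF, add_sub_add_left_eq_sub]
        rw [sub_eq_add_neg, ← Finset.sum_neg_distrib]
        congr 1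
        · refine Finset.sum_congr rfl fun i hi => ?_
          rw [(Finset.mem_filter.1 hi).2.neg_one_pow, one_mul, hϑ i (Finset.mem_filter.1 hi).1]
        · refine Finset.sum_congr rfl fun i hi => ?_
          rw [(Nat.not_even_iff_odd.1 (Finset.mem_filter.1 hi).2).neg_one_pow,
            hϑ i (Finset.mem_filter.1 hi).1]
          ring
      have hfac : ∀ Q : ℕ → ℝ, ∑ i ∈ Finset.range (m + 1), (c i : ℝ) * ((-1) ^ i * Q i) =
          w / 2 ^ (m - 1) * ∑ i ∈ Finset.range (m + 1), (-1 : ℝ) ^ i * m.choose i * Q i := by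
        intro Q
        rw [Finset.mul_sum]
        refine Finset.sum_congr rfl fun i _ => ?_
        simp only [hc]
        push_cast
        ring
      rw [hsplit, hfac, hfac fun i => R i x, hx])
    (fun x => by
      rw [← Finset.sum_filter_add_sum_filter_not _ (fun i => Even i)]
      have hT0 : 0 ≤ ∑ y ∈ T, v y * p x y :=
        Finset.sum_nonneg fun y _ => mul_nonneg (v y).2 (hpnn x y)
      have hEP : ∑ i ∈ E, c i * P i x = ∑ i ∈ E, c i * p x (ϑ i) :=
        Finset.sum_congr rfl fun i hi => by rw [hϑ i (Finset.mem_filter.1 hi).1]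
      have hOP : ∑ i ∈ O, c i * P i x = ∑ i ∈ O, c i * p x (ϑ i) :=
        Finset.sum_congr rfl fun i hi => by rw [hϑ i (Finset.mem_filter.1 hi).1]
      rw [hEP, hOP]
      simp only [hF]
      linarith)
    (by positivity) hRb
  -- The node `i` is at distance `iε` from `θ₀`, so the tent vanishes at every node but `0`, which
  -- is even. The common part `B` contributes equally to both integrals and cancels; the gap is `c 0
  -- * ε = 2 * (w * ε / 2 ^ m)`.
  set tent : Θ → ℝ≥0∞ := fun y => ENNReal.ofReal ε - edist y θ₀ with htent
  have htm : Measurable tent := measurable_const.sub (measurable_id.edist measurable_const)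
  have htsum : ∀ s, ∫⁻ y, tent y ∂(M s) = ∫⁻ y, tent y ∂B + ∑ i ∈ s, c i * tent (ϑ i) := by
    intro s
    simp only [hM]
    rw [lintegral_add_measure]
    congr 1
    rw [lintegral_finsetSum_measure]
    simp only [lintegral_smul_measure, lintegral_dirac, smul_eq_mul]
  have ht0 : ∀ i ∈ Finset.range (m + 1), i ≠ 0 → tent (ϑ i) = 0 := fun i hi h0 => by
    simp only [htent]
    rw [hdist i hi, tsub_eq_zero_iff_le]
    refine ENNReal.ofReal_le_ofReal (le_mul_of_one_le_left hε.le ?_)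
    exact_mod_cast Nat.one_le_iff_ne_zero.2 h0
  have htop : ∫⁻ y, tent y ∂B ≠ ∞ := by
    simp only [hB]
    rw [lintegral_finsetSum_measure]
    simp only [lintegral_smul_measure, lintegral_dirac, smul_eq_mul]
    exact ENNReal.sum_ne_top.2 fun y _ => ENNReal.mul_ne_top ENNReal.coe_ne_top
      (ne_top_of_le_ne_top ENNReal.ofReal_ne_top tsub_le_self)
  have hHtent : ∫⁻ y, tent y ∂(H : Measure Θ) = ∫⁻ y, tent y ∂B := by
    rw [hHM, htsum, Finset.sum_eq_zero, add_zero]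
    intro i hi
    rw [ht0 i (Finset.mem_filter.1 hi).1, mul_zero]
    rintro rfl
    exact (Finset.mem_filter.1 hi).2 (by simp)
  have h0mem : (0 : ℕ) ∈ Finset.range (m + 1) := by simp
  have hGtent : ∫⁻ y, tent y ∂(G : Measure Θ) = ∫⁻ y, tent y ∂B +
      2 * ENNReal.ofReal (w * ε / 2 ^ m) := by
    rw [hGM, htsum, Finset.sum_eq_single_of_mem 0 (Finset.mem_filter.2 ⟨h0mem, by simp⟩)
      fun i hi h0 => by rw [ht0 i (Finset.mem_filter.1 hi).1 h0, mul_zero]]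
    congr 1
    simp only [htent]
    rw [hdist 0 h0mem, Nat.cast_zero, zero_mul, ENNReal.ofReal_zero, tsub_zero,
      ← ENNReal.ofReal_coe_nnreal, ← ENNReal.ofReal_mul (by positivity),
      show (2 : ℝ≥0∞) = ENNReal.ofReal 2 by simp, ← ENNReal.ofReal_mul (by norm_num)]
    congr 1
    simp only [hc]
    obtain ⟨l, hl⟩ : ∃ l, m = l + 1 := ⟨m - 1, by omega⟩
    rw [hl, Nat.choose_zero_right, pow_succ]
    push_cast
    field_simp
  have hfinal := half_separation_le_minimaxRisk (μ := μ) (p := p) (n := n) hGS hHS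
    (ρ := (∫⁻ x, (ENNReal.ofReal (F E x) * ENNReal.ofReal (F O x)) ^ (1 / 2 : ℝ) ∂μ) ^ 2)
    (s := ENNReal.ofReal (w * ε / 2 ^ m))
    (fun c u v hu hv huv => by
      rw [hGd, hHd]
      exact mul_sq_affinity_le (hFm E).ennreal_ofReal (hFm O).ennreal_ofReal hu hv huv)
    (three_quarters_le_affinity_pow hεn hn haff) ENNReal.ofReal_ne_top htm
    (fun x y => by
      simp only [htent]
      rw [tsub_le_iff_right]
      calc ENNReal.ofReal ε ≤ ENNReal.ofReal ε - edist y θ₀ + edist y θ₀ := le_tsub_add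
        _ ≤ ENNReal.ofReal ε - edist y θ₀ + (edist x y + edist x θ₀) := by
          gcongr; rw [edist_comm x y]; exact edist_triangle _ _ _
        _ = _ := by rw [add_assoc])
    (by rw [hHtent]; exact htop) (by rw [hGtent, hHtent])
  refine le_trans (le_of_eq ?_) hfinal
  rw [← ENNReal.ofReal_ofNat 2, ← ENNReal.ofReal_div_of_pos (by norm_num)]
  congr 1
  rw [show 2 * d = m + 1 by omega, pow_succ]
  field_simp

theorem exists_local_minimax_constant (q d : ℕ) (A : ℝ≥0) (b a : ℝ) (w : ℝ≥0) (hd : 1 ≤ d)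
    (hb : 0 < b) (ha : 0 < a) (hw : 0 < w) :
    ∃ C : ℝ, 0 < C ∧
      ∀ (X : Type u) [MeasurableSpace X] (μ : Measure X) (Θ : Set (Param q))
        (p : X → Param q → ℝ), IsDensityFamily μ Θ p →
      ∀ k₀ k : ℕ, k₀ + d ≤ k + 1 →
      ∀ G₀ ∈ exactlyAtoms Θ k₀, ∀ θ₀ : Θ, G₀ {θ₀} = w →
      ∀ ψ : Param q, AssumptionA μ Θ p θ₀ (2 * d - 1) b ψ A →
      ∀ n : ℕ, 1 ≤ n →
        ENNReal.ofReal (C * (n : ℝ) ^ (-(1 / (4 * (d : ℝ) - 2)))) ≤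
          minimaxRisk μ p n
            {G | G ∈ atMostAtoms Θ k ∧ wasserstein1 G G₀ <
              ENNReal.ofReal (a * (n : ℝ) ^ (-(1 / (4 * (d : ℝ) - 2))))} := by
  set m := 2 * d - 1 with hm
  have hm1 : 1 ≤ m := by omega
  have hmpos : (0 : ℝ) < m := by exact_mod_cast hm1
  have hmd : (4 * (d : ℝ) - 2) = (2 * m : ℕ) := by
    rw [hm]; push_cast [show 1 ≤ 2 * d by omega]; ring
  -- The three bounds serve the radius `b`, the localisation `a` and the affinity condition. The
  -- added ones avoid division by zero and give `r * q ≤ 1`, so that `(r * q) ^ (2 * m) ≤ r * q`.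
  set r : ℝ := min (b / 2) (min (a / 2) (1 / (((q : ℝ) + 1) * (8 * A + 1)))) with hr
  have hrpos : 0 < r := by positivity
  have hrb : r < b := (min_le_left _ _).trans_lt (by linarith)
  have hra : r < a := ((min_le_right _ _).trans (min_le_left _ _)).trans_lt (by linarith)
  have hrq : r * q ≤ 1 / (8 * A + 1) := by
    calc r * q ≤ 1 / (((q : ℝ) + 1) * (8 * A + 1)) * (q + 1) := by
          gcongr
          · exact (min_le_right _ _).trans (min_le_right _ _)
          · linarith
      _ = _ := by field_simp
  refine ⟨w * (r / m) / 2 ^ (2 * d), by positivity, ?_⟩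
  intro X _ μ Θ p hp k₀ k hk G₀ hG₀ θ₀ hθ₀ ψ hA n hn
  have hn1 : (1 : ℝ) ≤ n := by exact_mod_cast hn
  have hnpos : (0 : ℝ) < n := by linarith
  rw [hmd]
  set η : ℝ := (n : ℝ) ^ (-(1 / ((2 * m : ℕ) : ℝ))) with hη
  have hηpos : 0 < η := Real.rpow_pos_of_pos hnpos _
  have hη1 : η ≤ 1 := Real.rpow_le_one_of_one_le_of_nonpos hn1 (by
    rw [neg_nonpos]; positivity)
  have hηpow : η ^ (2 * m) = (n : ℝ)⁻¹ := by
    rw [hη, ← Real.rpow_natCast, ← Real.rpow_mul hnpos.le, ← Real.rpow_neg_one]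
    congr 1
    have : ((2 * m : ℕ) : ℝ) ≠ 0 := by positivity
    field_simp
  have hmε : (m : ℝ) * (r / m * η) = r * η := by field_simp
  -- With this `ε` the reach of the nodes is `m * ε = r * η`, and `η ^ (2 * m) = 1 / n` balances the
  -- factor `n` of the affinity condition.
  have := ofReal_le_minimaxRisk_of_assumptionA hp hd hk hG₀ (θ₀ := θ₀) (by rw [hθ₀]; exact hw.ne')
    hA (ε := r / m * η) (by positivity) ?_ hn ?_ (S := {G | G ∈ atMostAtoms Θ k ∧
      wasserstein1 G G₀ < ENNReal.ofReal (a * η)}) ?_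
  · refine le_trans (le_of_eq ?_) this
    rw [hθ₀]
    congr 1
    ring
  · rw [hmε]
    exact (mul_le_of_le_one_right hrpos.le hη1).trans_lt hrb
  · rw [hmε]
    have h1 : (r * q) ^ (2 * m) ≤ 1 / (8 * A + 1) := by
      have hA1 : 1 / (8 * (A : ℝ) + 1) ≤ 1 := by
        rw [div_le_one (by positivity)]
        have := A.2
        linarith
      refine (pow_le_of_le_one (by positivity) (hrq.trans hA1) (by omega)).trans hrq
    calc 8 * n * ((r * η * q) ^ (2 * m) * A)
        = 8 * A * (r * q) ^ (2 * m) * (n * η ^ (2 * m)) := by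
          rw [show r * η * q = r * q * η by ring, mul_pow _ η]; ring
      _ = 8 * A * (r * q) ^ (2 * m) := by rw [hηpow, mul_inv_cancel₀ hnpos.ne', mul_one]
      _ ≤ 8 * A * (1 / (8 * A + 1)) := by gcongr
      _ ≤ 1 := by
          rw [mul_one_div, div_le_one (by positivity)]
          linarith
  · intro G hG hGW
    refine ⟨hG, hGW.trans_lt ?_⟩
    rw [hmε, ENNReal.ofReal_lt_ofReal_iff (by positivity)]
    gcongr

theorem exists_mem_exactlyAtoms_one {q : ℕ} {Θ : Set (Param q)} (θ : Θ) :
    ∃ G ∈ exactlyAtoms Θ 1, G {θ} = 1 := by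
  let G : ProbabilityMeasure Θ := ⟨Measure.dirac θ, inferInstance⟩
  have hG : (G : Measure Θ) = Measure.dirac θ := rfl
  refine ⟨G, ⟨fun _ => θ, fun _ => 1,
    Function.injective_of_subsingleton _, by simp, by simp [hG]⟩, ?_⟩
  rw [← ENNReal.coe_inj, ProbabilityMeasure.ennreal_coeFn_eq_coeFn_toMeasure, hG]
  simp

theorem minimaxRisk_mono {X : Type u} [MeasurableSpace X] {q n : ℕ} {μ : Measure X}
    {Θ : Set (Param q)} {p : X → Param q → ℝ} {S S' : Set (ProbabilityMeasure Θ)} (h : S ⊆ S') :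
    minimaxRisk μ p n S ≤ minimaxRisk μ p n S' :=
  iInf₂_mono fun _ _ => biSup_mono h

theorem theorem1 :
    -- the global bound: `C` depends on `q`, `k`, `A`, `b` only
    (∀ (q k : ℕ) (A : ℝ≥0) (b : ℝ), 1 ≤ k → 0 < b →
      ∃ C : ℝ, 0 < C ∧
        ∀ (X : Type u) [MeasurableSpace X] (μ : Measure X) (Θ : Set (Param q))
          (p : X → Param q → ℝ), IsDensityFamily μ Θ p →
        ∀ θ₀ ∈ Θ, ∀ ψ : Param q, AssumptionA μ Θ p θ₀ (2 * k - 1) b ψ A →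
        ∀ n : ℕ, 1 ≤ n →
          ENNReal.ofReal (C * (n : ℝ) ^ (-(1 / (4 * (k : ℝ) - 2)))) ≤
            minimaxRisk μ p n (atMostAtoms Θ k)) ∧
    -- the local bound: `C` depends on `q`, `d₁`, `A`, `b`, `a` and the mass `w` of `θ₀` only
    (∀ (q d₁ : ℕ) (A : ℝ≥0) (b a : ℝ) (w : ℝ≥0), 1 ≤ d₁ → 0 < b → 0 < a → 0 < w →
      ∃ C : ℝ, 0 < C ∧
        ∀ (X : Type u) [MeasurableSpace X] (μ : Measure X) (Θ : Set (Param q))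
          (p : X → Param q → ℝ), IsDensityFamily μ Θ p →
        ∀ k₀ k : ℕ, k₀ ≤ k → d₁ = k - k₀ + 1 →
        ∀ G₀ ∈ exactlyAtoms Θ k₀, ∀ θ₀ : Θ, G₀ {θ₀} = w →
        ∀ ψ : Param q, AssumptionA μ Θ p θ₀ (2 * d₁ - 1) b ψ A →
        ∀ n : ℕ, 1 ≤ n →
          ENNReal.ofReal (C * (n : ℝ) ^ (-(1 / (4 * (d₁ : ℝ) - 2)))) ≤
            minimaxRisk μ p n
              {G | G ∈ atMostAtoms Θ k ∧ wasserstein1 G G₀ <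
                ENNReal.ofReal (a * (n : ℝ) ^ (-(1 / (4 * (d₁ : ℝ) - 2))))}) := by
  refine ⟨fun q k A b hk hb => ?_, fun q d₁ A b a w hd hb ha hw => ?_⟩
  -- The global bound is the local one around `G₀ = δ_{θ₀}`, where `k₀ = 1`, `d = k` and `w = 1`;
  -- enlarging the class can only raise the risk.
  · obtain ⟨C, hC, h⟩ := exists_local_minimax_constant q k A b 1 1 hk hb one_pos one_pos
    refine ⟨C, hC, fun X _ μ Θ p hp θ₀ hθ₀ ψ hA n hn => ?_⟩
    obtain ⟨G₀, hG₀, hG₀1⟩ := exists_mem_exactlyAtoms_one (⟨θ₀, hθ₀⟩ : Θ)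
    exact (h X μ Θ p hp 1 k (by omega) G₀ hG₀ ⟨θ₀, hθ₀⟩ hG₀1 ψ hA n hn).trans
      (minimaxRisk_mono fun G hG => hG.1)
  · obtain ⟨C, hC, h⟩ := exists_local_minimax_constant q d₁ A b a w hd hb ha hw
    exact ⟨C, hC, fun X _ μ Θ p hp k₀ k hk hdk => h X μ Θ p hp k₀ k (by omega)⟩
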